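/- Let $X=(\mathcal A,\mathcal H,\pi,D)$ be a compact spectral metric space. That is: $\mathcal A$ is a separable unital $C^*$-algebra, $\pi$ is a faithful non-degenerate representation of $\mathcal A$ on a Hilbert space $\mathcal H$, and $D$ is a selfadjoint operator on $\mathcal H$ with compact resolvent such that * $C^1(X)=\{a\in\mathcal A:\ [D,\pi(a)]\text{ is bounded}\}$ is dense in $\mathcal A$; * the metric commutant $\mathcal A_D'=\{a\in\mathcal A:\ [D,\pi(a)]=0\}$ equals $\mathbb C\mathbf 1$; * for some strictly positive element $h\in\mathcal A$ (i.e. $h\ge 0$ with $h\mathcal A h$ dense in $\mathcal A$), the compressed Lipschitz ball $h\,B_{\mathrm{Lip}}(X)\,h$, where $B_{\mathrm{Lip}}(X)=\{a\in\mathcal A:\ \|[D,\pi(a)]\|\le 1\}$, has precompact image in $\mathcal A/\mathcal A_D'$. Let $\alpha$ be a $*$-automorphism of $\mathcal A$ generating an equicontinuous group: $\sup_{n\in\mathbb Z}\|[D,\pi(\alpha^n(a))]\|<\infty$ for every $a\in C^1(X)$. Let $\mathcal A\rtimes_\alpha\mathbb Z$ be the full crossed product, i.e. the universal $C^*$-algebra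 generated by $\mathcal A$ and a unitary $u$ with $uau^{-1}=\alpha(a)$. Let $\mathcal K=\mathcal H\otimes\ell^2(\mathbb Z)\otimes\mathbb C^2$, written as sequences $f=(f_n)_{n\in\mathbb Z}$ with $f_n\in\mathcal H\otimes\mathbb C^2$. Let $\hat\pi$ be the left regular representation of $\mathcal A\rtimes_\alpha\mathbb Z$ on $\mathcal K$, determined by $$(\hat\pi(a)f)_n=\pi(\alpha^{-n}(a))f_n\quad(a\in\mathcal A),\qquad (\hat\pi(u)f)_n=f_{n-1},$$ and let $\widehat D$ be the operator on $\mathcal K$, with its maximal domain, given by $$(\widehat Df)_n=\begin{pmatrix}0&D-\imath n\\ D+\imath n&0\end{pmatrix}f_n .$$ Let $Y=X\rtimes_\alpha\mathbb Z=(\mathcal A\rtimes_\alpha\mathbb Z,\mathcal K,\hat\pi,\widehat D)$ be the regular representation of $(X,\alpha)$. Then the image of the Lipschitz ball $\{b\in\mathcal A\rtimes_\alpha\mathbb Z:\ \|[\widehat D,\hat\pi(b)]\|\le 1\}$ in the quotient of $\mathcal A\rtimes_\alpha\mathbb Z$ by the $\widehat D$-commutant $\{b:\ [\widehat D,\hat\pi(b)]=0\}$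 is compact. Moreover, $Y$ is a compact spectral metric space. -/

import Mathlib

noncomputable section

namespace CrossedProductZ

variable {A : Type*} [CStarAlgebra A]

/-- The C⋆-algebra `A`, regarded as carrying the action `n ↦ αⁿ` of `ℤ` (written
multiplicatively). -/
def Coeff (_α : A ≃⋆ₐ[ℂ] A) : Type _ := A

variable (α : A ≃⋆ₐ[ℂ] A)

instance : CStarAlgebra (Coeff α) := inferInstanceAs (CStarAlgebra A)

instance : MulSemiringAction (Multiplicative ℤ) (Coeff α) where
  smul n a := (α ^ n.toAdd) a
  one_smul a := by change (α ^ (0 : ℤ)) a = a; rw [zpow_zero]; rfl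
  mul_smul m n a := by
    change (α ^ (m.toAdd + n.toAdd)) a = (α ^ m.toAdd) ((α ^ n.toAdd) a)
    rw [zpow_add]; rfl
  smul_zero n := map_zero (α ^ n.toAdd)
  smul_add n := map_add (α ^ n.toAdd)
  smul_one n := map_one (α ^ n.toAdd)
  smul_mul n := map_mul (α ^ n.toAdd)

theorem smul_def (n : Multiplicative ℤ) (a : Coeff α) : n • a = (α ^ n.toAdd) a := rfl

theorem smul_star (n : Multiplicative ℤ) (a : Coeff α) : n • star a = star (n • a) :=
  map_star (α ^ n.toAdd) a

theorem norm_smul_eq (n : Multiplicative ℤ) (a : Coeff α) : ‖n • a‖ = ‖a‖ :=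
  StarAlgEquiv.norm_map (α ^ n.toAdd) a

instance : SMulCommClass (Multiplicative ℤ) ℂ (Coeff α) where
  smul_comm n c a := map_smul (α ^ n.toAdd) c a

/-- `C_c(ℤ, A)`: finite sums `∑ aₙ uⁿ` with `(a uᵐ)(b uⁿ) = a αᵐ(b) uᵐ⁺ⁿ`. The monomial
`a uⁿ` is `SkewMonoidAlgebra.single (Multiplicative.ofAdd n) a`. -/
abbrev FiniteSums : Type _ := SkewMonoidAlgebra (Coeff α) (Multiplicative ℤ)

open SkewMonoidAlgebra

/-- The involution: `(a uⁿ)⋆ = u⁻ⁿ a⋆ = α⁻ⁿ(a⋆) u⁻ⁿ`. -/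
instance : Star (FiniteSums α) where
  star f := f.sum fun n a => single n⁻¹ (n⁻¹ • star a)

theorem star_single (n : Multiplicative ℤ) (a : Coeff α) :
    star (single n a : FiniteSums α) = single n⁻¹ (n⁻¹ • star a) :=
  sum_single_index (by simp)

theorem star_add_aux (f g : FiniteSums α) : star (f + g) = star f + star g :=
  sum_add_index (by simp) (by simp [smul_add, single_add])

instance : StarRing (FiniteSums α) where
  star_involutive f := by
    induction f using SkewMonoidAlgebra.induction_on' with
    | single n a => simp [star_single, smul_star]
    | add f g hf hg => rw [star_add_aux, star_add_aux, hf, hg]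
  star_add := star_add_aux α
  star_mul f g := by
    induction f using SkewMonoidAlgebra.induction_on' with
    | add f₁ f₂ h₁ h₂ => rw [add_mul, star_add_aux, star_add_aux, mul_add, h₁, h₂]
    | single m a =>
      induction g using SkewMonoidAlgebra.induction_on' with
      | add g₁ g₂ h₁ h₂ => rw [mul_add, star_add_aux, star_add_aux, add_mul, h₁, h₂]
      | single n b =>
        simp only [single_mul_single, star_single, star_mul, smul_mul', mul_inv_rev, mul_smul,
          ← smul_star, inv_smul_smul]

instance : StarModule ℂ (FiniteSums α) where
  star_smul c f := by
    induction f using SkewMonoidAlgebra.induction_on' with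
    | add f g hf hg => rw [smul_add, star_add, star_add, smul_add, hf, hg]
    | single n a => rw [smul_single, star_single, star_single, smul_single, star_smul, smul_comm]

/-- The `ℓ¹`-norm `∑ ‖aₙ‖`. -/
def l1Norm (f : FiniteSums α) : ℝ := f.sum fun _ a => ‖a‖

/-- C⋆-seminorms on `C_c(ℤ, A)` dominated by the `ℓ¹`-norm. -/
structure IsCStarSeminorm (p : Seminorm ℂ (FiniteSums α)) : Prop where
  mul_le : ∀ f g, p (f * g) ≤ p f * p g
  star_mul_self : ∀ f, p (star f * f) = p f * p f
  le_l1Norm : ∀ f, p f ≤ l1Norm α f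

/-- The norm of the full crossed product: the largest of these C⋆-seminorms. -/
def maxNorm (f : FiniteSums α) : ℝ :=
  ⨆ p : {p : Seminorm ℂ (FiniteSums α) // IsCStarSeminorm α p}, p.1 f

instance : Nonempty {p : Seminorm ℂ (FiniteSums α) // IsCStarSeminorm α p} :=
  ⟨0, by simp, by simp, fun f => Finset.sum_nonneg fun _ _ => norm_nonneg _⟩

theorem bddAbove_range (f : FiniteSums α) :
    BddAbove (Set.range fun p : {p : Seminorm ℂ (FiniteSums α) // IsCStarSeminorm α p} => p.1 f) :=
  ⟨l1Norm α f, by rintro _ ⟨p, rfl⟩; exact p.2.le_l1Norm f⟩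

theorem le_maxNorm {p : Seminorm ℂ (FiniteSums α)} (hp : IsCStarSeminorm α p)
    (f : FiniteSums α) : p f ≤ maxNorm α f :=
  le_ciSup (bddAbove_range α f) ⟨p, hp⟩

theorem maxNorm_le {f : FiniteSums α} {C : ℝ}
    (h : ∀ p : Seminorm ℂ (FiniteSums α), IsCStarSeminorm α p → p f ≤ C) : maxNorm α f ≤ C :=
  ciSup_le fun p => h p.1 p.2

theorem maxNorm_nonneg (f : FiniteSums α) : 0 ≤ maxNorm α f :=
  Real.iSup_nonneg fun p => apply_nonneg p.1 f

theorem maxNorm_star_mul_self (f : FiniteSums α) :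
    maxNorm α (star f * f) = maxNorm α f * maxNorm α f := by
  apply le_antisymm
  · refine maxNorm_le α fun p hp => ?_
    rw [hp.star_mul_self]
    exact mul_self_le_mul_self (apply_nonneg p f) (le_maxNorm α hp f)
  · have h : maxNorm α f ≤ √(maxNorm α (star f * f)) := maxNorm_le α fun p hp =>
      Real.le_sqrt_of_sq_le (by rw [sq, ← hp.star_mul_self]; exact le_maxNorm α hp _)
    calc maxNorm α f * maxNorm α f
        ≤ √(maxNorm α (star f * f)) * √(maxNorm α (star f * f)) :=
          mul_self_le_mul_self (maxNorm_nonneg α f) h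
      _ = maxNorm α (star f * f) := Real.mul_self_sqrt (maxNorm_nonneg α _)

theorem maxNorm_mul_le (f g : FiniteSums α) :
    maxNorm α (f * g) ≤ maxNorm α f * maxNorm α g :=
  maxNorm_le α fun p hp => (hp.mul_le f g).trans
    (mul_le_mul (le_maxNorm α hp f) (le_maxNorm α hp g) (apply_nonneg p g) (maxNorm_nonneg α f))

theorem maxNorm_smul (c : ℂ) (f : FiniteSums α) : maxNorm α (c • f) = ‖c‖ * maxNorm α f := by
  simp only [maxNorm, map_smul_eq_mul]
  exact (Real.mul_iSup_of_nonneg (norm_nonneg c) _).symm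

/-- `C_c(ℤ, A)` with the norm `maxNorm`. -/
def NormedFiniteSums : Type _ := FiniteSums α

instance : Ring (NormedFiniteSums α) := inferInstanceAs (Ring (FiniteSums α))

instance : Algebra ℂ (NormedFiniteSums α) := inferInstanceAs (Algebra ℂ (FiniteSums α))

instance : StarRing (NormedFiniteSums α) := inferInstanceAs (StarRing (FiniteSums α))

instance : SeminormedRing (NormedFiniteSums α) :=
  RingSeminorm.toSeminormedRing (R := NormedFiniteSums α)
    { toFun := maxNorm α
      map_zero' := by
        refine le_antisymm (maxNorm_le α fun p _ => ?_) (maxNorm_nonneg α _)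
        exact (map_zero p).le
      add_le' := fun f g => maxNorm_le α fun p hp => (map_add_le_add p (f : FiniteSums α) g).trans
        (add_le_add (le_maxNorm α hp f) (le_maxNorm α hp g))
      neg' := fun f => congrArg iSup (funext fun p => map_neg_eq_map p.1 (f : FiniteSums α))
      mul_le' := maxNorm_mul_le α }

instance : NormedAlgebra ℂ (NormedFiniteSums α) where
  norm_smul_le c f := (maxNorm_smul α c f).le

theorem maxNorm_star_le (f : FiniteSums α) : maxNorm α (star f) ≤ maxNorm α f := by
  have h : maxNorm α (star f) * maxNorm α (star f) ≤ maxNorm α f * maxNorm α (star f) := by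
    have := maxNorm_star_mul_self α (star f)
    rw [star_star] at this
    exact this.symm.le.trans (maxNorm_mul_le α f (star f))
  rcases (maxNorm_nonneg α (star f)).eq_or_lt with h0 | h0
  · rw [← h0]; exact maxNorm_nonneg α f
  · exact le_of_mul_le_mul_right h h0

instance : NormedStarGroup (NormedFiniteSums α) := ⟨maxNorm_star_le α⟩

end CrossedProductZ

/-- The crossed product `A ⋊_α ℤ`: the completion of `C_c(ℤ, A)` for the largest C⋆-seminorm
dominated by the `ℓ¹`-norm, i.e. the enveloping C⋆-algebra of `ℓ¹(ℤ, A)`. This is the universal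
C⋆-algebra generated by `A` and a unitary `u` with `u a u⁻¹ = α(a)`. -/
def CrossedProductZ {A : Type*} [CStarAlgebra A] (α : A ≃⋆ₐ[ℂ] A) : Type _ :=
  UniformSpace.Completion (CrossedProductZ.NormedFiniteSums α)

namespace CrossedProductZ
open UniformSpace
variable {A : Type*} [CStarAlgebra A] (α : A ≃⋆ₐ[ℂ] A)

instance : NormedRing (CrossedProductZ α) :=
  inferInstanceAs (NormedRing (Completion (NormedFiniteSums α)))
instance : CompleteSpace (CrossedProductZ α) :=
  inferInstanceAs (CompleteSpace (Completion (NormedFiniteSums α)))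

/-- The canonical map from `C_c(ℤ, A)`, with dense range. -/
def of (f : FiniteSums α) : CrossedProductZ α :=
  ((show NormedFiniteSums α from f) : Completion (NormedFiniteSums α))

instance : Algebra ℂ (CrossedProductZ α) :=
  inferInstanceAs (Algebra ℂ (Completion (NormedFiniteSums α)))

instance : NormedAlgebra ℂ (CrossedProductZ α) where
  norm_smul_le := norm_smul_le (α := ℂ) (β := Completion (NormedFiniteSums α))

instance : Star (CrossedProductZ α) where
  star := Completion.map (star : NormedFiniteSums α → NormedFiniteSums α)

theorem denseRange_of : DenseRange (of α) :=
  Completion.denseRange_coe (α := NormedFiniteSums α)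

theorem of_add (f g : FiniteSums α) : of α (f + g) = of α f + of α g :=
  Completion.coe_add (α := NormedFiniteSums α) f g

theorem of_mul (f g : FiniteSums α) : of α (f * g) = of α f * of α g :=
  Completion.coe_mul (α := NormedFiniteSums α) f g

theorem of_smul (c : ℂ) (f : FiniteSums α) : of α (c • f) = c • of α f :=
  Completion.coe_smul (X := NormedFiniteSums α) c f

theorem norm_of (f : FiniteSums α) : ‖of α f‖ = maxNorm α f :=
  Completion.norm_coe (E := NormedFiniteSums α) f

theorem of_star (f : FiniteSums α) : of α (star f) = star (of α f) :=
  (Completion.map_coe (α := NormedFiniteSums α) (β := NormedFiniteSums α)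
    (starNormedAddGroupHom (E := NormedFiniteSums α)).uniformContinuous f).symm

theorem continuous_star' : Continuous (star : CrossedProductZ α → CrossedProductZ α) :=
  Completion.continuous_map

/-- A closed condition on the crossed product holds everywhere if it holds on `C_c(ℤ, A)`. -/
theorem induction_of {p : CrossedProductZ α → Prop} (hc : IsClosed {b | p b})
    (h : ∀ f, p (of α f)) (b : CrossedProductZ α) : p b :=
  Completion.induction_on (α := NormedFiniteSums α) b hc h

theorem induction_of₂ {p : CrossedProductZ α → CrossedProductZ α → Prop}
    (hc : IsClosed {b : CrossedProductZ α × CrossedProductZ α | p b.1 b.2})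
    (h : ∀ f g, p (of α f) (of α g)) (b c : CrossedProductZ α) : p b c :=
  Completion.induction_on₂ (α := NormedFiniteSums α) (β := NormedFiniteSums α) b c hc h

instance : StarRing (CrossedProductZ α) where
  star_involutive b := by
    induction b using induction_of with
    | hc => exact isClosed_eq ((continuous_star' α).comp (continuous_star' α)) continuous_id
    | h f => rw [← of_star, ← of_star, star_star]
  star_add b c := by
    induction b, c using induction_of₂ with
    | hc =>
      have := continuous_star' α
      exact isClosed_eq (by fun_prop) (by fun_prop)
    | h f g => rw [← of_add, ← of_star, star_add, of_add, of_star, of_star]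
  star_mul b c := by
    induction b, c using induction_of₂ with
    | hc =>
      have := continuous_star' α
      exact isClosed_eq (by fun_prop) (by fun_prop)
    | h f g => rw [← of_mul, ← of_star, star_mul, of_mul, of_star, of_star]

instance : StarModule ℂ (CrossedProductZ α) where
  star_smul c b := by
    induction b using induction_of with
    | hc =>
      exact isClosed_eq ((continuous_star' α).comp (continuous_const_smul c))
        ((continuous_const_smul (star c)).comp (continuous_star' α))
    | h f => rw [← of_smul, ← of_star, star_smul, of_smul, of_star]

instance : CStarRing (CrossedProductZ α) where
  norm_mul_self_le b := by
    induction b using induction_of with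
    | hc =>
      have := continuous_star' α
      exact isClosed_le (by fun_prop) (by fun_prop)
    | h f => rw [← of_star, ← of_mul, norm_of, norm_of, maxNorm_star_mul_self]

instance : CStarAlgebra (CrossedProductZ α) where

end CrossedProductZ

/-! ### Spectral triples and spectral metric spaces -/

/-- The data `(A, H, π, D)` underlying a spectral triple: a representation `π` of `A` on `H` and a
partially defined operator `D`. -/
structure SpectralData (A : Type*) [CStarAlgebra A] (H : Type*) [NormedAddCommGroup H]
    [InnerProductSpace ℂ H] [CompleteSpace H] where
  rep : A →⋆ₙₐ[ℂ] (H →L[ℂ] H)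
  dirac : H →ₗ.[ℂ] H

/-- `b` preserves the domain of `D` and the bounded operator `T` extends `[D, b] = D b - b D`.
For closed `D` this is the same as asking it on some core of `D` invariant under `b`. -/
def IsCommutator {H : Type*} [NormedAddCommGroup H] [InnerProductSpace ℂ H]
    (D : H →ₗ.[ℂ] H) (b T : H →L[ℂ] H) : Prop :=
  ∀ x : D.domain, ∃ h : b x ∈ D.domain, D ⟨b x, h⟩ - b (D x) = T x

/-- `(D - z)⁻¹` exists as a compact operator for some `z`. -/
def HasCompactResolvent {H : Type*} [NormedAddCommGroup H] [InnerProductSpace ℂ H]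
    (D : H →ₗ.[ℂ] H) : Prop :=
  ∃ (z : ℂ) (R : H →L[ℂ] H), IsCompactOperator R ∧
    (∀ y, ∃ h : R y ∈ D.domain, D ⟨R y, h⟩ - z • R y = y) ∧
    ∀ x : D.domain, R (D x - z • (x : H)) = x

/-- A strictly positive element: a positive `h` with `hAh` dense. -/
def IsStrictlyPositiveElement {A : Type*} [CStarAlgebra A] (h : A) : Prop :=
  (∃ x, h = star x * x) ∧ Dense (Set.range fun a => h * a * h)

namespace SpectralData

variable {A : Type*} [CStarAlgebra A] {H : Type*} [NormedAddCommGroup H]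
  [InnerProductSpace ℂ H] [CompleteSpace H] (X : SpectralData A H)

/-- `C¹(X)`, the elements with bounded commutator `[D, a]`. -/
def C1 : Set A := {a | ∃ T, IsCommutator X.dirac (X.rep a) T}

/-- The Lipschitz ball `{a | ‖[D, a]‖ ≤ 1}`. -/
def lipBall : Set A := {a | ∃ T, IsCommutator X.dirac (X.rep a) T ∧ ‖T‖ ≤ 1}

/-- The metric commutant (`D`-commutant) `{a | [D, a] = 0}`. -/
def commutant : Submodule ℂ A where
  carrier := {a | IsCommutator X.dirac (X.rep a) 0}
  zero_mem' x := by
    have h : X.rep 0 (x : H) = 0 := by simp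
    refine ⟨h ▸ X.dirac.domain.zero_mem, ?_⟩
    have : (⟨X.rep 0 (x : H), h ▸ X.dirac.domain.zero_mem⟩ : X.dirac.domain) = 0 := Subtype.ext h
    rw [this]; simp
  add_mem' {a b} ha hb x := by
    obtain ⟨h₁, e₁⟩ := ha x
    obtain ⟨h₂, e₂⟩ := hb x
    have h : X.rep (a + b) (x : H) = X.rep a x + X.rep b x := by simp
    refine ⟨h ▸ X.dirac.domain.add_mem h₁ h₂, ?_⟩
    have e : (⟨X.rep (a + b) (x : H), h ▸ X.dirac.domain.add_mem h₁ h₂⟩ : X.dirac.domain) =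
      ⟨_, h₁⟩ + ⟨_, h₂⟩ := Subtype.ext h
    rw [e, LinearPMap.map_add, map_add, add_apply, add_sub_add_comm, e₁, e₂]
    simp
  smul_mem' c a ha x := by
    obtain ⟨h₁, e₁⟩ := ha x
    have h : X.rep (c • a) (x : H) = c • X.rep a x := by simp
    refine ⟨h ▸ X.dirac.domain.smul_mem c h₁, ?_⟩
    have e : (⟨X.rep (c • a) (x : H), h ▸ X.dirac.domain.smul_mem c h₁⟩ : X.dirac.domain) =
      c • ⟨_, h₁⟩ := Subtype.ext h
    rw [e, LinearPMap.map_smul, map_smul, smul_apply, ← smul_sub, e₁]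
    simp

/-- `(A, H, π, D)` is a spectral triple. The representation is faithful, as `A` is identified
with its image in `B(H)`. -/
structure IsSpectralTriple : Prop where
  separable : TopologicalSpace.SeparableSpace A
  faithful : Function.Injective X.rep
  isSelfAdjoint : IsSelfAdjoint X.dirac
  compactResolvent : HasCompactResolvent X.dirac
  dense_C1 : Dense X.C1

/-- `X` is a compact spectral metric space (`A` being unital): a spectral triple with nondegenerate
representation, trivial metric commutant, and, for some strictly positive `h`, `h`-compressed
Lipschitz ball precompact modulo the metric commutant. -/
structure IsCompactSpectralMetricSpace : Prop extends X.IsSpectralTriple where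
  nondegenerate :
    (Submodule.span ℂ {y : H | ∃ a x, X.rep a x = y}).topologicalClosure = ⊤
  commutant_eq : X.commutant = Submodule.span ℂ {1}
  precompact_lipBall : ∃ h : A, IsStrictlyPositiveElement h ∧
    IsCompact (closure (X.commutant.mkQ '' ((fun a => h * a * h) '' X.lipBall)))

/-- `C_b¹(G, X)`: the `a` with `sup_{g ∈ G} ‖[D, g(a)]‖ < ∞`. -/
def C1b (G : Subgroup (A ≃⋆ₐ[ℂ] A)) : Set A :=
  {a | ∃ C : ℝ, ∀ g ∈ G, ∃ T, IsCommutator X.dirac (X.rep (g a)) T ∧ ‖T‖ ≤ C}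

/-- The group `G` is equicontinuous: `C¹(X) = C_b¹(G, X)`. -/
def IsEquicontinuous (G : Subgroup (A ≃⋆ₐ[ℂ] A)) : Prop := X.C1 = X.C1b G

end SpectralData

/-! ### The regular representation -/

/-- The orthogonal direct sum of a sequence of unbounded operators, on its maximal domain. -/
def LinearPMap.l2Sum {E : Type*} [NormedAddCommGroup E] [InnerProductSpace ℂ E]
    (T : ℤ → E →ₗ.[ℂ] E) : lp (fun _ : ℤ => E) 2 →ₗ.[ℂ] lp (fun _ : ℤ => E) 2 where
  domain :=
    { carrier := {f | ∃ h : ∀ n, f n ∈ (T n).domain, Memℓp (fun n => T n ⟨f n, h n⟩) 2}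
      zero_mem' := ⟨fun n => (T n).domain.zero_mem, by
        convert zero_memℓp (E := fun _ : ℤ => E) with n
        exact (T n).map_zero⟩
      add_mem' := by
        rintro f g ⟨hf, hf'⟩ ⟨hg, hg'⟩
        refine ⟨fun n => (T n).domain.add_mem (hf n) (hg n), ?_⟩
        convert hf'.add hg' with n
        exact (T n).map_add ⟨f n, hf n⟩ ⟨g n, hg n⟩
      smul_mem' := by
        rintro c f ⟨hf, hf'⟩
        refine ⟨fun n => (T n).domain.smul_mem c (hf n), ?_⟩
        convert hf'.const_smul c with n
        exact (T n).map_smul c ⟨f n, hf n⟩ }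
  toFun :=
    { toFun := fun f => ⟨fun n => T n ⟨f.1 n, f.2.1 n⟩, f.2.2⟩
      map_add' := fun f g => by
        ext n; exact (T n).map_add ⟨f.1 n, f.2.1 n⟩ ⟨g.1 n, g.2.1 n⟩
      map_smul' := fun c f => by
        ext n; exact (T n).map_smul c ⟨f.1 n, f.2.1 n⟩ }

namespace SpectralData

/-- The Hilbert space `K = H ⊗ ℓ²(ℤ) ⊗ ℂ²`, realized as `ℓ²(ℤ, H ⊕ H)`. -/
abbrev RegSpace (H : Type*) [NormedAddCommGroup H] [InnerProductSpace ℂ H] : Type _ :=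
  lp (fun _ : ℤ => WithLp 2 (H × H)) 2

/-- The translation by `m`, `(ûᵐ f)ₙ = fₙ₋ₘ`. -/
def shift (H : Type*) [NormedAddCommGroup H] [InnerProductSpace ℂ H] (m : Multiplicative ℤ) :
    RegSpace H →L[ℂ] RegSpace H :=
  LinearMap.mkContinuous
    { toFun := fun f => ⟨fun n => f (n - m.toAdd), by
        have := lp.memℓp f
        rw [memℓp_gen_iff (by norm_num)] at this
        exact (memℓp_gen_iff (by norm_num)).mpr ((Equiv.subRight m.toAdd).summable_iff.mpr this)⟩
      map_add' := fun _ _ => rfl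
      map_smul' := fun _ _ => rfl }
    1 (fun f => by
      rw [one_mul, lp.norm_eq_tsum_rpow (by norm_num), lp.norm_eq_tsum_rpow (by norm_num)]
      exact (congrArg (· ^ _) ((Equiv.subRight m.toAdd).tsum_eq fun n => ‖f n‖ ^ _)).le)

theorem shift_apply {H : Type*} [NormedAddCommGroup H] [InnerProductSpace ℂ H]
    (m : Multiplicative ℤ) (f : RegSpace H) (n : ℤ) :
    shift H m f n = f (n - m.toAdd) := rfl

theorem norm_shift_le {H : Type*} [NormedAddCommGroup H] [InnerProductSpace ℂ H]
    (m : Multiplicative ℤ) : ‖shift H m‖ ≤ 1 :=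
  LinearMap.mkContinuous_norm_le _ zero_le_one _

theorem shift_mul {H : Type*} [NormedAddCommGroup H] [InnerProductSpace ℂ H]
    (m n : Multiplicative ℤ) : shift H (m * n) = shift H m * shift H n :=
  ContinuousLinearMap.ext fun f => lp.ext <| funext fun k => by
    change f (k - (m.toAdd + n.toAdd)) = f (k - m.toAdd - n.toAdd)
    rw [sub_sub]

variable {A : Type*} [CStarAlgebra A] {H : Type*} [NormedAddCommGroup H]
  [InnerProductSpace ℂ H] [CompleteSpace H]

/-- `D ⊗ σ₁ + n 1 ⊗ σ₂` on `H ⊗ ℂ² = H ⊕ H`, that is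
`(v₊, v₋) ↦ (D v₋ - i n v₋, D v₊ + i n v₊)`. -/
def diracBlock (D : H →ₗ.[ℂ] H) (n : ℤ) : WithLp 2 (H × H) →ₗ.[ℂ] WithLp 2 (H × H) where
  domain := (D.domain.prod D.domain).comap (WithLp.linearEquiv 2 ℂ (H × H)).toLinearMap
  toFun :=
    { toFun := fun v => WithLp.toLp 2
        (D ⟨v.1.snd, v.2.2⟩ - (Complex.I * n) • v.1.snd,
          D ⟨v.1.fst, v.2.1⟩ + (Complex.I * n) • v.1.fst)
      map_add' := fun v w => by
        rw [WithLp.ext_iff]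
        exact Prod.ext
          (by
            change D (⟨v.1.snd, v.2.2⟩ + ⟨w.1.snd, w.2.2⟩) - _ • (v.1.snd + w.1.snd) = _ - _ + (_ - _)
            rw [D.map_add, smul_add, add_sub_add_comm])
          (by
            change D (⟨v.1.fst, v.2.1⟩ + ⟨w.1.fst, w.2.1⟩) + _ • (v.1.fst + w.1.fst) = _ + _ + (_ + _)
            rw [D.map_add, smul_add, add_add_add_comm])
      map_smul' := fun c v => by
        rw [WithLp.ext_iff]
        exact Prod.ext
          (by
            change D (c • ⟨v.1.snd, v.2.2⟩) - _ • (c • v.1.snd) = c • (_ - _)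
            rw [D.map_smul, smul_sub, smul_comm])
          (by
            change D (c • ⟨v.1.fst, v.2.1⟩) + _ • (c • v.1.fst) = c • (_ + _)
            rw [D.map_smul, smul_add, smul_comm]) }

/-- `a ↦ π(a) ⊗ 1` on `H ⊗ ℂ² = H ⊕ H`. -/
def doubleRep (π : A →⋆ₙₐ[ℂ] (H →L[ℂ] H)) :
    A →⋆ₙₐ[ℂ] (WithLp 2 (H × H) →L[ℂ] WithLp 2 (H × H)) where
  toFun a := (WithLp.prodContinuousLinearEquiv 2 ℂ H H).symm.toContinuousLinearMap ∘L
    ((π a).prodMap (π a)) ∘L (WithLp.prodContinuousLinearEquiv 2 ℂ H H).toContinuousLinearMap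
  map_smul' c a := by
    refine ContinuousLinearMap.ext fun v => (WithLp.ofLp_injective 2) (Prod.ext ?_ ?_)
    · change π (c • a) v.fst = c • π a v.fst
      simp
    · change π (c • a) v.snd = c • π a v.snd
      simp
  map_zero' := by
    refine ContinuousLinearMap.ext fun v => (WithLp.ofLp_injective 2) (Prod.ext ?_ ?_)
    · change π 0 v.fst = 0
      simp
    · change π 0 v.snd = 0
      simp
  map_add' a b := by
    refine ContinuousLinearMap.ext fun v => (WithLp.ofLp_injective 2) (Prod.ext ?_ ?_)
    · change π (a + b) v.fst = π a v.fst + π b v.fst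
      simp
    · change π (a + b) v.snd = π a v.snd + π b v.snd
      simp
  map_mul' a b := by
    refine ContinuousLinearMap.ext fun v => (WithLp.ofLp_injective 2) (Prod.ext ?_ ?_)
    · change π (a * b) v.fst = π a (π b v.fst)
      simp
    · change π (a * b) v.snd = π a (π b v.snd)
      simp
  map_star' a := by
    rw [ContinuousLinearMap.star_eq_adjoint, ContinuousLinearMap.eq_adjoint_iff]
    intro v w
    rw [WithLp.prod_inner_apply, WithLp.prod_inner_apply]
    change inner ℂ (π (star a) v.fst) w.fst + inner ℂ (π (star a) v.snd) w.snd =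
      inner ℂ v.fst (π a w.fst) + inner ℂ v.snd (π a w.snd)
    rw [map_star, ContinuousLinearMap.star_eq_adjoint, ContinuousLinearMap.adjoint_inner_left,
      ContinuousLinearMap.adjoint_inner_left]

/-- `(π̂(a) f)ₙ = π(α⁻ⁿ(a)) fₙ`. -/
def regRepCoeff (α : A ≃⋆ₐ[ℂ] A) (π : A →⋆ₙₐ[ℂ] (H →L[ℂ] H)) :
    A →⋆ₙₐ[ℂ] (RegSpace H →L[ℂ] RegSpace H) where
  toFun a := lp.mapCLM 2 (fun n : ℤ => doubleRep π ((α ^ (-n)) a)) (norm_nonneg a) fun n =>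
    (NonUnitalStarAlgHom.norm_apply_le (doubleRep π) _).trans
      (StarAlgEquiv.norm_map (α ^ (-n)) a).le
  map_smul' c a := by
    refine ContinuousLinearMap.ext fun f => lp.ext (funext fun n => ?_)
    change doubleRep π ((α ^ (-n)) (c • a)) (f n) = c • doubleRep π ((α ^ (-n)) a) (f n)
    rw [map_smul, map_smul, smul_apply]
  map_zero' := by
    refine ContinuousLinearMap.ext fun f => lp.ext (funext fun n => ?_)
    change doubleRep π ((α ^ (-n)) 0) (f n) = 0
    rw [map_zero, map_zero, zero_apply]
  map_add' a b := by
    refine ContinuousLinearMap.ext fun f => lp.ext (funext fun n => ?_)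
    change doubleRep π ((α ^ (-n)) (a + b)) (f n) =
      doubleRep π ((α ^ (-n)) a) (f n) + doubleRep π ((α ^ (-n)) b) (f n)
    rw [map_add, map_add, add_apply]
  map_mul' a b := by
    refine ContinuousLinearMap.ext fun f => lp.ext (funext fun n => ?_)
    change doubleRep π ((α ^ (-n)) (a * b)) (f n) =
      doubleRep π ((α ^ (-n)) a) (doubleRep π ((α ^ (-n)) b) (f n))
    rw [map_mul, map_mul, mul_apply_eq_comp]
  map_star' a := by
    rw [ContinuousLinearMap.star_eq_adjoint, ContinuousLinearMap.eq_adjoint_iff]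
    intro f g
    rw [lp.inner_eq_tsum, lp.inner_eq_tsum]
    refine tsum_congr fun n => ?_
    change inner ℂ (doubleRep π ((α ^ (-n)) (star a)) (f n)) (g n) =
      inner ℂ (f n) (doubleRep π ((α ^ (-n)) a) (g n))
    rw [map_star, map_star, ContinuousLinearMap.star_eq_adjoint,
      ContinuousLinearMap.adjoint_inner_left]

theorem regRepCoeff_apply (α : A ≃⋆ₐ[ℂ] A) (π : A →⋆ₙₐ[ℂ] (H →L[ℂ] H)) (a : A)
    (f : RegSpace H) (n : ℤ) :
    regRepCoeff α π a f n = doubleRep π ((α ^ (-n)) a) (f n) := rfl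

theorem star_shift (m : Multiplicative ℤ) : star (shift H m) = shift H m⁻¹ := by
  symm
  rw [ContinuousLinearMap.star_eq_adjoint, ContinuousLinearMap.eq_adjoint_iff]
  intro f g
  rw [lp.inner_eq_tsum, lp.inner_eq_tsum, ← (Equiv.subRight m.toAdd).tsum_eq]
  refine tsum_congr fun n => ?_
  change inner ℂ (f (n - m.toAdd - -m.toAdd)) (g (n - m.toAdd)) = inner ℂ (f n) (g (n - m.toAdd))
  rw [sub_neg_eq_add, sub_add_cancel]

/-- The covariance relation `ûᵐ π̂(a) = π̂(αᵐ(a)) ûᵐ`. -/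
theorem shift_mul_regRepCoeff (α : A ≃⋆ₐ[ℂ] A) (π : A →⋆ₙₐ[ℂ] (H →L[ℂ] H))
    (m : Multiplicative ℤ) (a : A) :
    shift H m * regRepCoeff α π a = regRepCoeff α π ((α ^ m.toAdd) a) * shift H m :=
  ContinuousLinearMap.ext fun f => lp.ext <| funext fun k => by
    change doubleRep π ((α ^ (-(k - m.toAdd))) a) (f (k - m.toAdd)) =
      doubleRep π ((α ^ (-k)) ((α ^ m.toAdd) a)) (f (k - m.toAdd))
    rw [← StarAlgEquiv.mul_apply, ← zpow_add]
    congr 4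
    ring

open CrossedProductZ

/-- `regRepCoeff`, with the coefficient algebra regarded as an algebra with `ℤ`-action. -/
def regRepCoeff' (α : A ≃⋆ₐ[ℂ] A) (π : A →⋆ₙₐ[ℂ] (H →L[ℂ] H)) :
    Coeff α →⋆ₙₐ[ℂ] (RegSpace H →L[ℂ] RegSpace H) := regRepCoeff α π

theorem shift_mul_regRepCoeff' (α : A ≃⋆ₐ[ℂ] A) (π : A →⋆ₙₐ[ℂ] (H →L[ℂ] H))
    (m : Multiplicative ℤ) (a : Coeff α) :
    shift H m * regRepCoeff' α π a = regRepCoeff' α π (m • a) * shift H m :=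
  shift_mul_regRepCoeff α π m a

/-- `π̂(∑ aₙ uⁿ) = ∑ π̂(aₙ) ûⁿ` for finite sums. -/
def regRepFinite (α : A ≃⋆ₐ[ℂ] A) (π : A →⋆ₙₐ[ℂ] (H →L[ℂ] H)) :
    FiniteSums α →+ (RegSpace H →L[ℂ] RegSpace H) :=
  SkewMonoidAlgebra.liftNC (k := Coeff α) (AddMonoidHomClass.toAddMonoidHom (regRepCoeff' α π))
    (shift H)

variable (α : A ≃⋆ₐ[ℂ] A) (π : A →⋆ₙₐ[ℂ] (H →L[ℂ] H))

theorem regRepFinite_single (n : Multiplicative ℤ) (a : Coeff α) :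
    regRepFinite α π (SkewMonoidAlgebra.single n a) = regRepCoeff' α π a * shift H n :=
  SkewMonoidAlgebra.liftNC_single ..

theorem regRepFinite_smul (c : ℂ) (f : FiniteSums α) :
    regRepFinite α π (c • f) = c • regRepFinite α π f := by
  induction f using SkewMonoidAlgebra.induction_on' with
  | add f g hf hg => rw [smul_add, map_add, map_add, smul_add, hf, hg]
  | single n a =>
    rw [SkewMonoidAlgebra.smul_single, regRepFinite_single, regRepFinite_single, ← smul_mul_assoc]
    exact congrArg (· * _) (map_smul (regRepCoeff' α π) c a)

theorem regRepFinite_mul (f g : FiniteSums α) :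
    regRepFinite α π (f * g) = regRepFinite α π f * regRepFinite α π g := by
  induction f using SkewMonoidAlgebra.induction_on' with
  | add f₁ f₂ h₁ h₂ => rw [add_mul, map_add, map_add, add_mul, h₁, h₂]
  | single m a =>
    induction g using SkewMonoidAlgebra.induction_on' with
    | add g₁ g₂ h₁ h₂ => rw [mul_add, map_add, map_add, mul_add, h₁, h₂]
    | single n b =>
      rw [SkewMonoidAlgebra.single_mul_single, regRepFinite_single, regRepFinite_single, regRepFinite_single,
        shift_mul, mul_assoc, ← mul_assoc (shift H m), shift_mul_regRepCoeff', ← mul_assoc,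
        ← mul_assoc, ← mul_assoc, ← map_mul, mul_assoc]

theorem regRepFinite_star (f : FiniteSums α) :
    regRepFinite α π (star f) = star (regRepFinite α π f) := by
  induction f using SkewMonoidAlgebra.induction_on' with
  | add f g hf hg => rw [star_add, map_add, map_add, star_add, hf, hg]
  | single n a =>
    rw [star_single, regRepFinite_single, regRepFinite_single, star_mul, star_shift, ← map_star,
      shift_mul_regRepCoeff']

theorem norm_regRepFinite_le_l1Norm (f : FiniteSums α) : ‖regRepFinite α π f‖ ≤ l1Norm α f := by
  conv_lhs => rw [← SkewMonoidAlgebra.sum_single f, SkewMonoidAlgebra.sum_def', _root_.map_sum]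
  refine (norm_sum_le _ _).trans (Finset.sum_le_sum fun n _ => ?_)
  rw [regRepFinite_single]
  refine (norm_mul_le _ _).trans ?_
  calc _ ≤ ‖regRepCoeff' α π (f.coeff n)‖ * 1 :=
        mul_le_mul_of_nonneg_left (norm_shift_le n) (norm_nonneg _)
    _ ≤ ‖f.coeff n‖ := by
        rw [mul_one]; exact NonUnitalStarAlgHom.norm_apply_le (regRepCoeff' α π) _

theorem norm_star_mul_self_clm {E : Type*} [NormedAddCommGroup E] [InnerProductSpace ℂ E]
    [CompleteSpace E] (T : E →L[ℂ] E) : ‖star T * T‖ = ‖T‖ * ‖T‖ :=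
  CStarRing.norm_star_mul_self

/-- The C⋆-seminorm `f ↦ ‖π̂(f)‖` on `C_c(ℤ, A)`. -/
def regSeminorm : Seminorm ℂ (FiniteSums α) :=
  Seminorm.of (fun f => ‖regRepFinite α π f‖)
    (fun f g => by rw [map_add]; exact norm_add_le _ _)
    (fun c f => by rw [regRepFinite_smul, norm_smul])

theorem regSeminorm_apply (f : FiniteSums α) : regSeminorm α π f = ‖regRepFinite α π f‖ := rfl

theorem isCStarSeminorm_regSeminorm : IsCStarSeminorm α (regSeminorm α π) where
  mul_le f g := by
    rw [regSeminorm_apply, regSeminorm_apply, regSeminorm_apply, regRepFinite_mul]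
    exact norm_mul_le _ _
  star_mul_self f := by
    rw [regSeminorm_apply, regSeminorm_apply, regRepFinite_mul, regRepFinite_star]
    exact norm_star_mul_self_clm _
  le_l1Norm f := norm_regRepFinite_le_l1Norm α π f

theorem norm_regRepFinite_le (f : FiniteSums α) : ‖regRepFinite α π f‖ ≤ maxNorm α f :=
  le_maxNorm α (isCStarSeminorm_regSeminorm α π) f

/-- `regRepFinite` as a map on the normed algebra `NormedFiniteSums`. -/
def regRepPre : NormedFiniteSums α →+ (RegSpace H →L[ℂ] RegSpace H) := regRepFinite α π

theorem uniformContinuous_regRepPre : UniformContinuous (regRepPre α π) :=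
  AddMonoidHomClass.uniformContinuous_of_bound (regRepPre α π) 1 fun f => by
    rw [one_mul]; exact norm_regRepFinite_le α π f

theorem extension_of (f : FiniteSums α) :
    UniformSpace.Completion.extension (regRepPre α π) (of α f) = regRepFinite α π f :=
  UniformSpace.Completion.extension_coe (uniformContinuous_regRepPre α π) f

theorem continuous_extension :
    Continuous (fun b : CrossedProductZ α =>
      UniformSpace.Completion.extension (regRepPre α π) b) :=
  UniformSpace.Completion.continuous_extension

/-- The left regular representation `π̂` of `A ⋊ ℤ` on `K`, the continuous extension of
`∑ aₙ uⁿ ↦ ∑ π̂(aₙ) ûⁿ`. -/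
def regRep : CrossedProductZ α →⋆ₙₐ[ℂ] (RegSpace H →L[ℂ] RegSpace H) where
  toFun b := UniformSpace.Completion.extension (regRepPre α π) b
  map_smul' c b := by
    have hc := continuous_extension α π
    induction b using induction_of with
    | hc => exact isClosed_eq (hc.comp (continuous_const_smul c)) (hc.const_smul c)
    | h f => rw [← of_smul, extension_of, extension_of, regRepFinite_smul]; rfl
  map_zero' := by
    have := extension_of α π 0
    rw [map_zero] at this
    exact this
  map_add' b c := by
    have hc := continuous_extension α π
    induction b, c using induction_of₂ with
    | hc => exact isClosed_eq (hc.comp continuous_add) (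
        (hc.comp continuous_fst).add (hc.comp continuous_snd))
    | h f g => rw [← of_add, extension_of, extension_of, extension_of, map_add]
  map_mul' b c := by
    have hc := continuous_extension α π
    induction b, c using induction_of₂ with
    | hc => exact isClosed_eq (hc.comp continuous_mul) (
        (hc.comp continuous_fst).mul (hc.comp continuous_snd))
    | h f g => rw [← of_mul, extension_of, extension_of, extension_of, regRepFinite_mul]
  map_star' b := by
    have hc := continuous_extension α π
    induction b using induction_of with
    | hc => exact isClosed_eq (hc.comp (continuous_star' α)) hc.star
    | h f => rw [← of_star, extension_of, extension_of, regRepFinite_star]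

theorem regRep_of (f : FiniteSums α) : regRep α π (of α f) = regRepFinite α π f :=
  extension_of α π f

/-- The regular representation `X ⋊ ℤ = (A ⋊ ℤ, K, π̂, D̂)` where `D̂` acts on the `n`-th
component of `K = ℓ²(ℤ, H ⊕ H)` as `D ⊗ σ₁ + n 1 ⊗ σ₂`. -/
def regularRepresentation (X : SpectralData A H) (α : A ≃⋆ₐ[ℂ] A) :
    SpectralData (CrossedProductZ α) (RegSpace H) where
  rep := regRep α X.rep
  dirac := LinearPMap.l2Sum (diracBlock X.dirac)

end SpectralData

end

noncomputable section

open CrossedProductZ SpectralData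

namespace CrossedProductZ

variable {A : Type*} [CStarAlgebra A] (α : A ≃⋆ₐ[ℂ] A)

/-- The coefficient `aₖ` of the finite sum `∑ aₖ uᵏ`. -/
def finCoeff (k : ℤ) : FiniteSums α →ₗ[ℂ] A where
  toFun f := f.coeff (Multiplicative.ofAdd k)
  map_add' f g := by rw [SkewMonoidAlgebra.coeff_add]; rfl
  map_smul' c f := by rw [SkewMonoidAlgebra.coeff_smul]; rfl

/-- The monomial `a uᵏ`. -/
def monomial (k : ℤ) (a : A) : FiniteSums α :=
  SkewMonoidAlgebra.single (Multiplicative.ofAdd k) (show Coeff α from a)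

theorem finCoeff_monomial (k l : ℤ) (a : A) :
    finCoeff α k (monomial α l a) = if l = k then a else 0 := by
  change (SkewMonoidAlgebra.single (Multiplicative.ofAdd l) (show Coeff α from a)).coeff
    (Multiplicative.ofAdd k) = _
  rw [SkewMonoidAlgebra.coeff_single_apply]
  rfl

theorem induction_monomial {p : FiniteSums α → Prop} (f : FiniteSums α)
    (hm : ∀ k a, p (monomial α k a)) (ha : ∀ f g, p f → p g → p (f + g)) : p f := by
  induction f using SkewMonoidAlgebra.induction_on' with
  | single n a => exact hm n.toAdd a
  | add f g hf hg => exact ha f g hf hg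

theorem monomial_add (k : ℤ) (a b : A) :
    monomial α k (a + b) = monomial α k a + monomial α k b :=
  SkewMonoidAlgebra.single_add _ _ _

theorem monomial_smul (k : ℤ) (c : ℂ) (a : A) :
    monomial α k (c • a) = c • monomial α k a :=
  (SkewMonoidAlgebra.smul_single c (Multiplicative.ofAdd k) (show Coeff α from a)).symm

theorem l1Norm_monomial (k : ℤ) (a : A) : l1Norm α (monomial α k a) = ‖a‖ :=
  SkewMonoidAlgebra.sum_single_index norm_zero

theorem maxNorm_le_l1Norm (f : FiniteSums α) : maxNorm α f ≤ l1Norm α f :=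
  maxNorm_le α fun _ hp => hp.le_l1Norm f

/-- The map `a ↦ a uᵏ` from `A` to the crossed product. -/
def monomialCLM (k : ℤ) : A →L[ℂ] CrossedProductZ α :=
  LinearMap.mkContinuous
    { toFun := fun a => of α (monomial α k a)
      map_add' := fun a b => by rw [monomial_add, of_add]
      map_smul' := fun c a => by rw [monomial_smul, of_smul]; rfl }
    1 fun a => by
      rw [one_mul]
      change ‖of α (monomial α k a)‖ ≤ _
      rw [norm_of, ← l1Norm_monomial α k a]
      exact maxNorm_le_l1Norm α _

theorem monomialCLM_apply (k : ℤ) (a : A) : monomialCLM α k a = of α (monomial α k a) := rfl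

theorem monomialCLM_zero_one : monomialCLM α 0 1 = 1 := rfl

end CrossedProductZ

namespace SpectralData

variable {A : Type*} [CStarAlgebra A] {H : Type*} [NormedAddCommGroup H]
  [InnerProductSpace ℂ H] [CompleteSpace H] (α : A ≃⋆ₐ[ℂ] A) (π : A →⋆ₙₐ[ℂ] (H →L[ℂ] H))

theorem doubleRep_apply (a : A) (v : WithLp 2 (H × H)) :
    doubleRep π a v = WithLp.toLp 2 (π a v.fst, π a v.snd) := rfl

theorem continuous_doubleRep : Continuous (doubleRep π) :=
  AddMonoidHomClass.continuous_of_bound (doubleRep π) 1 fun a => by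
    rw [one_mul]; exact NonUnitalStarAlgHom.norm_apply_le (doubleRep π) a

theorem regRepFinite_monomial_apply (k : ℤ) (a : A) (g : RegSpace H) (n : ℤ) :
    regRepFinite α π (monomial α k a) g n = doubleRep π ((α ^ (-n)) a) (g (n - k)) := by
  rw [monomial, regRepFinite_single]; rfl

theorem regRepFinite_lp_single (f : FiniteSums α) (m n : ℤ) (v : WithLp 2 (H × H)) :
    regRepFinite α π f (lp.single 2 m v) n =
      doubleRep π ((α ^ (-n)) (finCoeff α (n - m) f)) v := by
  induction f using induction_monomial with
  | hm k a =>
    rw [regRepFinite_monomial_apply, finCoeff_monomial]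
    by_cases h : k = n - m
    · have : n - k = m := by omega
      rw [if_pos h, this, lp.single_apply_self]
    · have : n - k ≠ m := by omega
      rw [if_neg h, lp.single_apply_ne _ _ _ this]
      simp
  | ha f g hf hg =>
    rw [map_add, map_add, map_add, map_add, add_apply, add_apply, lp.coeFn_add, Pi.add_apply,
      hf, hg]

theorem norm_finCoeff_le (hπ : Function.Injective π) (k : ℤ) (f : FiniteSums α) :
    ‖finCoeff α k f‖ ≤ ‖regRepFinite α π f‖ := by
  rw [← NonUnitalStarAlgHom.norm_map π hπ]
  refine ContinuousLinearMap.opNorm_le_bound _ (norm_nonneg _) fun x => ?_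
  have h := regRepFinite_lp_single α π f (-k) 0 (WithLp.toLp 2 (x, 0))
  simp only [zero_sub, neg_neg, neg_zero, zpow_zero] at h
  have h2 := (lp.norm_apply_le_norm (by norm_num) (regRepFinite α π f
    (lp.single 2 (-k) (WithLp.toLp 2 (x, 0)))) 0).trans (ContinuousLinearMap.le_opNorm _ _)
  have e : doubleRep π ((1 : A ≃⋆ₐ[ℂ] A) (finCoeff α k f)) (WithLp.toLp 2 (x, 0)) =
      WithLp.toLp 2 (π (finCoeff α k f) x, 0) := by
    rw [doubleRep_apply]
    change WithLp.toLp 2 (π (finCoeff α k f) x, π (finCoeff α k f) 0) = _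
    rw [map_zero]
  rw [h, e, lp.norm_single (by norm_num), WithLp.norm_toLp_fst, WithLp.norm_toLp_fst] at h2
  exact h2

theorem l1Norm_le (hπ : Function.Injective π) (f : FiniteSums α) :
    l1Norm α f ≤ f.support.card * ‖regRepFinite α π f‖ := by
  rw [l1Norm, SkewMonoidAlgebra.sum_def', ← nsmul_eq_mul]
  exact Finset.sum_le_card_nsmul _ _ _ fun n _ => norm_finCoeff_le α π hπ n.toAdd f

theorem exists_support_subset (f : FiniteSums α) : ∃ R : ℕ, ∀ n ∈ f.support,
    n.toAdd ∈ Finset.Icc (-R : ℤ) R := by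
  refine ⟨f.support.sup fun n => n.toAdd.natAbs, fun n hn => ?_⟩
  have := Finset.le_sup (f := fun n : Multiplicative ℤ => n.toAdd.natAbs) hn
  rw [Finset.mem_Icc]
  omega

theorem support_pow_subset (f : FiniteSums α) {R : ℕ}
    (hR : ∀ n ∈ f.support, n.toAdd ∈ Finset.Icc (-R : ℤ) R) (j : ℕ) :
    ∀ n ∈ (f ^ j).support, n.toAdd ∈ Finset.Icc (-(j * R : ℕ) : ℤ) (j * R : ℕ) := by
  induction j with
  | zero =>
    intro n hn
    rw [pow_zero] at hn
    have := SkewMonoidAlgebra.support_one_subset hn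
    rw [Finset.mem_one] at this
    simp [this]
  | succ j ih =>
    intro n hn
    rw [pow_succ] at hn
    obtain ⟨a, ha, b, hb, rfl⟩ := Finset.mem_mul.mp (SkewMonoidAlgebra.support_mul _ _ hn)
    have h1 := ih a ha
    have h2 := hR b hb
    rw [Finset.mem_Icc] at *
    rw [toAdd_mul]
    push_cast at *
    constructor <;> linarith [h1.1, h1.2, h2.1, h2.2]

theorem card_support_pow_le (f : FiniteSums α) {R : ℕ}
    (hR : ∀ n ∈ f.support, n.toAdd ∈ Finset.Icc (-R : ℤ) R) (j : ℕ) :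
    (f ^ j).support.card ≤ 2 * (j * R) + 1 := by
  have h := Finset.card_le_card_of_injOn (t := Finset.Icc (-(j * R : ℕ) : ℤ) (j * R : ℕ))
    (fun n : Multiplicative ℤ => n.toAdd) (support_pow_subset α f hR j)
    (Multiplicative.toAdd.injective.injOn)
  rw [Int.card_Icc] at h
  omega

/-- If `2 ^ j`-th powers of `M` are dominated by those of `r` up to a linear factor,
then `M ≤ r`. -/
theorem le_of_pow_two_pow_le {M r : ℝ} (hr : 0 ≤ r) (R : ℕ)
    (h : ∀ j : ℕ, M ^ 2 ^ j ≤ (2 * ((2 ^ j : ℕ) * R) + 1 : ℝ) * r ^ 2 ^ j) : M ≤ r := by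
  by_contra! hlt
  have hM : 0 < M := hr.trans_lt hlt
  have hq : 0 ≤ r / M := div_nonneg hr hM.le
  have hq1 : r / M < 1 := (div_lt_one hM).mpr hlt
  have h1 := tendsto_self_mul_const_pow_of_lt_one hq hq1
  have h2 := tendsto_pow_atTop_nhds_zero_of_lt_one hq hq1
  have h3 : Filter.Tendsto (fun n : ℕ => 2 * R * (n * (r / M) ^ n) + (r / M) ^ n)
      Filter.atTop (nhds 0) := by
    simpa using (h1.const_mul (2 * R : ℝ)).add h2
  have h4 := h3.comp (tendsto_pow_atTop_atTop_of_one_lt one_lt_two)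
  have h5 : ∀ j : ℕ, 1 ≤ ((fun n : ℕ => 2 * R * (n * (r / M) ^ n) + (r / M) ^ n) ∘
      fun j => 2 ^ j) j := fun j => by
    have hp : 0 < M ^ 2 ^ j := pow_pos hM _
    simp only [Function.comp_apply, div_pow]
    have e : 2 * R * (((2 ^ j : ℕ) : ℝ) * (r ^ 2 ^ j / M ^ 2 ^ j)) + r ^ 2 ^ j / M ^ 2 ^ j =
      ((2 * ((2 ^ j : ℕ) * R) + 1 : ℝ) * r ^ 2 ^ j) / M ^ 2 ^ j := by ring
    rw [e, le_div_iff₀ hp, one_mul]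
    exact h j
  have := ge_of_tendsto' h4 h5
  linarith

theorem regRepFinite_pow (f : FiniteSums α) (j : ℕ) :
    ‖regRepFinite α π (f ^ (j + 1))‖ ≤ ‖regRepFinite α π f‖ ^ (j + 1) := by
  induction j with
  | zero => simp
  | succ j ih =>
    rw [pow_succ, regRepFinite_mul, pow_succ _ (j + 1)]
    exact (norm_mul_le _ _).trans (mul_le_mul_of_nonneg_right ih (norm_nonneg _))

theorem of_pow (f : FiniteSums α) (j : ℕ) : of α (f ^ j) = of α f ^ j := by
  induction j with
  | zero => rw [pow_zero, pow_zero]; rfl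
  | succ j ih => rw [pow_succ, of_mul, ih, pow_succ]

/-- As `ℤ` has subexponential growth, the full and the reduced norm agree. -/
theorem maxNorm_eq (hπ : Function.Injective π) (f : FiniteSums α) :
    maxNorm α f = ‖regRepFinite α π f‖ := by
  refine le_antisymm ?_ (norm_regRepFinite_le α π f)
  obtain ⟨R, hR⟩ := exists_support_subset α (star f * f)
  have hs : IsSelfAdjoint (of α (star f * f)) := by
    rw [of_mul, of_star]; exact IsSelfAdjoint.star_mul_self _
  have key : maxNorm α (star f * f) ≤ ‖regRepFinite α π (star f * f)‖ := by
    refine le_of_pow_two_pow_le (norm_nonneg _) R fun j => ?_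
    rw [← norm_of, ← hs.norm_pow_two_pow, ← of_pow, norm_of]
    refine (maxNorm_le_l1Norm α _).trans ((l1Norm_le α π hπ _).trans ?_)
    refine mul_le_mul ?_ ?_ (norm_nonneg _) (by positivity)
    · exact_mod_cast card_support_pow_le α _ hR (2 ^ j)
    · obtain ⟨i, hi⟩ := Nat.exists_eq_succ_of_ne_zero (pow_ne_zero j (two_ne_zero (α := ℕ)))
      rw [hi]
      exact regRepFinite_pow α π _ i
  rw [maxNorm_star_mul_self, regRepFinite_mul, regRepFinite_star, norm_star_mul_self_clm] at key
  exact le_of_sq_le_sq (by simpa [sq] using key) (norm_nonneg _)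

theorem norm_regRep (hπ : Function.Injective π) (b : CrossedProductZ α) :
    ‖regRep α π b‖ = ‖b‖ := by
  induction b using induction_of with
  | hc => exact isClosed_eq (continuous_extension α π).norm continuous_norm
  | h f => rw [regRep_of, norm_of, maxNorm_eq α π hπ]

theorem regRep_injective (hπ : Function.Injective π) : Function.Injective (regRep α π) := by
  intro b c h
  rw [← sub_eq_zero, ← norm_eq_zero, ← norm_regRep α π hπ, map_sub, h, sub_self, norm_zero]

/-- The coefficient `aₖ` as a continuous linear map on finite sums. -/
def finCoeffCLM (hπ : Function.Injective π) (k : ℤ) : NormedFiniteSums α →L[ℂ] A :=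
  LinearMap.mkContinuous (show NormedFiniteSums α →ₗ[ℂ] A from finCoeff α k) 1 fun f => by
    rw [one_mul]
    exact (norm_finCoeff_le α π hπ k f).trans (norm_regRepFinite_le α π f)

/-- The Fourier coefficient `b ↦ bₖ`. -/
def fourierCoeff (hπ : Function.Injective π) (k : ℤ) : CrossedProductZ α →L[ℂ] A :=
  (finCoeffCLM α π hπ k).extend
    (UniformSpace.Completion.toComplL (𝕜 := ℂ) (E := NormedFiniteSums α))

theorem fourierCoeff_of (hπ : Function.Injective π) (k : ℤ) (f : FiniteSums α) :
    fourierCoeff α π hπ k (of α f) = finCoeff α k f :=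
  (finCoeffCLM α π hπ k).extend_eq
    (UniformSpace.Completion.denseRange_coe (α := NormedFiniteSums α))
    (UniformSpace.Completion.isUniformInducing_coe (NormedFiniteSums α)) f

theorem continuous_regRep : Continuous (regRep α π) := continuous_extension α π

theorem regRep_lp_single (hπ : Function.Injective π) (b : CrossedProductZ α) (m n : ℤ)
    (v : WithLp 2 (H × H)) :
    regRep α π b (lp.single 2 m v) n =
      doubleRep π ((α ^ (-n)) (fourierCoeff α π hπ (n - m) b)) v := by
  induction b using induction_of with
  | hc =>
    have h1 : Continuous fun b => regRep α π b (lp.single 2 m v) n :=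
      (lp.evalCLM ℂ (fun _ : ℤ => WithLp 2 (H × H)) 2 n).continuous.comp
        ((continuous_regRep α π).clm_apply continuous_const)
    have h2 : Continuous (α ^ (-n)) := (StarAlgEquiv.isometry (α ^ (-n))).continuous
    exact isClosed_eq h1 (((continuous_doubleRep π).comp
      (h2.comp (fourierCoeff α π hπ (n - m)).continuous)).clm_apply continuous_const)
  | h f => rw [regRep_of, fourierCoeff_of, regRepFinite_lp_single]

end SpectralData

namespace LinearPMap

variable {E : Type*} [NormedAddCommGroup E] [InnerProductSpace ℂ E] {D : E →ₗ.[ℂ] E}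

theorem IsFormalAdjoint.norm_sub_smul_sq (hD : D.IsFormalAdjoint D) (t : ℝ) (x : D.domain) :
    ‖D x - (t * Complex.I) • (x : E)‖ ^ 2 = ‖D x‖ ^ 2 + t ^ 2 * ‖(x : E)‖ ^ 2 := by
  have h0 : (inner ℂ (D x) (x : E)).im = 0 := by
    rw [← Complex.conj_eq_iff_im, inner_conj_symm]
    exact (hD x x).symm
  rw [norm_sub_sq (𝕜 := ℂ), inner_smul_right, norm_smul]
  have h1 : (inner ℂ (D x) (x : E)).im = 0 := h0
  simp [h1, mul_pow, mul_comm]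

theorem IsFormalAdjoint.abs_mul_norm_le (hD : D.IsFormalAdjoint D) (t : ℝ) (x : D.domain) :
    |t| * ‖(x : E)‖ ≤ ‖D x - (t * Complex.I) • (x : E)‖ := by
  refine abs_le_of_sq_le_sq' ?_ (norm_nonneg _) |>.2
  rw [hD.norm_sub_smul_sq, mul_pow, sq_abs]
  nlinarith [sq_nonneg ‖D x‖]

/-- `R` is the resolvent `(D - w)⁻¹`. -/
def IsResolvent (D : E →ₗ.[ℂ] E) (w : ℂ) (R : E →L[ℂ] E) : Prop :=
  (∀ y, ∃ h : R y ∈ D.domain, D ⟨R y, h⟩ - w • R y = y) ∧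
    ∀ x : D.domain, R (D x - w • (x : E)) = x

theorem exists_isResolvent (w : ℂ) {c : ℝ} (hc : 0 < c)
    (hle : ∀ x : D.domain, c * ‖(x : E)‖ ≤ ‖D x - w • (x : E)‖)
    (hsurj : ∀ y, ∃ x : D.domain, D x - w • (x : E) = y) :
    ∃ R : E →L[ℂ] E, D.IsResolvent w R ∧ ‖R‖ ≤ c⁻¹ := by
  let T : D.domain →ₗ[ℂ] E := D.toFun - w • D.domain.subtype
  have hT : ∀ x, T x = D x - w • (x : E) := fun _ => rfl
  have hinj : Function.Injective T := by
    rw [← LinearMap.ker_eq_bot, LinearMap.ker_eq_bot']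
    intro x hx
    have := hle x
    rw [← hT, hx, norm_zero] at this
    exact Subtype.ext (norm_le_zero_iff.mp (nonpos_of_mul_nonpos_right this hc))
  let e := LinearEquiv.ofBijective T ⟨hinj, hsurj⟩
  have he : ∀ y, D (e.symm y) - w • (e.symm y : E) = y := fun y => e.apply_symm_apply y
  refine ⟨(D.domain.subtype ∘ₗ e.symm.toLinearMap).mkContinuous c⁻¹ fun y => ?_,
    ⟨fun y => ⟨(e.symm y).2, he y⟩, fun x => ?_⟩,
    LinearMap.mkContinuous_norm_le _ (inv_nonneg.mpr hc.le) _⟩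
  · rw [← div_eq_inv_mul, le_div_iff₀ hc, mul_comm]
    exact (hle (e.symm y)).trans_eq (congrArg _ (he y))
  · exact congrArg Subtype.val (e.symm_apply_apply x)

variable [CompleteSpace E]

theorem _root_.IsSelfAdjoint.isFormalAdjoint (hD : IsSelfAdjoint D) : D.IsFormalAdjoint D := by
  have h := adjoint_isFormalAdjoint hD.dense_domain
  rwa [isSelfAdjoint_def.mp hD] at h

theorem _root_.IsSelfAdjoint.exists_mem_domain (hD : IsSelfAdjoint D) {y w : E}
    (h : ∀ x : D.domain, inner ℂ w (x : E) = inner ℂ y (D x)) :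
    ∃ hy : y ∈ D.domain, D ⟨y, hy⟩ = w := by
  have hd := hD.dense_domain
  have hy : y ∈ D.domain := by
    have := mem_adjoint_domain_of_exists y ⟨w, h⟩
    rwa [isSelfAdjoint_def.mp hD] at this
  refine ⟨hy, hd.eq_of_inner_left ℂ fun v hv => ?_⟩
  rw [h ⟨v, hv⟩]
  exact hD.isFormalAdjoint ⟨y, hy⟩ ⟨v, hv⟩

theorem _root_.IsSelfAdjoint.sub_smul_surjective (hD : IsSelfAdjoint D) {t : ℝ} (ht : t ≠ 0)
    (y : E) : ∃ x : D.domain, D x - (t * Complex.I) • (x : E) = y := by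
  let T : D.domain →ₗ[ℂ] E := D.toFun - (t * Complex.I) • D.domain.subtype
  have hT : ∀ x, T x = D x - (t * Complex.I) • (x : E) := fun _ => rfl
  have hS := hD.isFormalAdjoint
  have hle : ∀ x : D.domain, |t| * ‖(x : E)‖ ≤ ‖T x‖ := hS.abs_mul_norm_le t
  have ht' : 0 < |t| := abs_pos.mpr ht
  have hclosed : _root_.IsClosed (LinearMap.range T : Set E) := by
    refine isClosed_of_closure_subset fun z hz => ?_
    obtain ⟨u, hu, huz⟩ := mem_closure_iff_seq_limit.mp hz
    choose x hx using hu
    have hc : CauchySeq fun n => (x n : E) := by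
      rw [Metric.cauchySeq_iff']
      intro ε hε
      obtain ⟨N, hN⟩ := Metric.cauchySeq_iff'.mp huz.cauchySeq (|t| * ε) (mul_pos ht' hε)
      refine ⟨N, fun n hn => ?_⟩
      have h1 := hN n hn
      rw [dist_eq_norm, ← hx, ← hx, ← LinearMap.map_sub] at h1
      have h2 := (hle _).trans_lt h1
      rw [dist_eq_norm]
      exact lt_of_mul_lt_mul_left h2 ht'.le
    obtain ⟨a, ha⟩ := cauchySeq_tendsto_of_complete hc
    have hDa : Filter.Tendsto (fun n => D (x n)) Filter.atTop
        (nhds (z + (t * Complex.I) • a)) := by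
      refine (huz.add (ha.const_smul (t * Complex.I))).congr fun n => ?_
      rw [← hx, hT, sub_add_cancel]
    obtain ⟨h, e⟩ := hD.exists_mem_domain (y := a) (w := z + (t * Complex.I) • a) fun v => by
      refine tendsto_nhds_unique (hDa.inner tendsto_const_nhds)
        ((ha.inner tendsto_const_nhds).congr fun n => (hS (x n) v).symm)
    exact ⟨⟨a, h⟩, by rw [hT, e, add_sub_cancel_right]⟩
  have htop : LinearMap.range T = ⊤ := by
    rw [← hclosed.submodule_topologicalClosure_eq, Submodule.topologicalClosure_eq_top_iff,
      Submodule.eq_bot_iff]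
    intro v hv
    have h1 : ∀ x : D.domain, inner ℂ (-(t * Complex.I) • v) (x : E) = inner ℂ v (D x) := by
      intro x
      have h2 := Submodule.inner_left_of_mem_orthogonal (LinearMap.mem_range_self T x) hv
      rw [hT, inner_sub_right, inner_smul_right, sub_eq_zero] at h2
      rw [h2, inner_smul_left]
      simp
    obtain ⟨h, e⟩ := hD.exists_mem_domain h1
    have h3 := hS.abs_mul_norm_le (-t) ⟨v, h⟩
    rw [e] at h3
    have h4 : -(t * Complex.I) • v - ((-t : ℝ) * Complex.I) • v = 0 := by
      push_cast; rw [neg_mul, sub_self]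
    rw [h4, norm_zero, abs_neg] at h3
    exact norm_le_zero_iff.mp (nonpos_of_mul_nonpos_right h3 ht')
  exact LinearMap.range_eq_top.mp htop y

/-- A symmetric operator `D` with `D - i` and `D + i` surjective is self-adjoint. -/
theorem IsFormalAdjoint.isSelfAdjoint (hD : D.IsFormalAdjoint D)
    (h₁ : ∀ y, ∃ x : D.domain, D x - Complex.I • (x : E) = y)
    (h₂ : ∀ y, ∃ x : D.domain, D x - (-Complex.I) • (x : E) = y) : IsSelfAdjoint D := by
  have key : ∀ x y : D.domain, inner ℂ (D x - Complex.I • (x : E)) (y : E) =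
      inner ℂ (x : E) (D y - (-Complex.I) • (y : E)) := fun x y => by
    rw [inner_sub_left, inner_sub_right, hD, inner_smul_left, inner_smul_right, Complex.conj_I]
  have hd : Dense (D.domain : Set E) := by
    rw [Submodule.dense_iff_topologicalClosure_eq_top, Submodule.topologicalClosure_eq_top_iff,
      Submodule.eq_bot_iff]
    intro v hv
    obtain ⟨x, rfl⟩ := h₁ v
    have hx : (x : E) = 0 := by
      refine ext_inner_right ℂ fun u => ?_
      obtain ⟨y, rfl⟩ := h₂ u
      rw [← key, inner_zero_left]
      exact Submodule.inner_left_of_mem_orthogonal y.2 hv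
    have hx' : x = 0 := Subtype.ext hx
    rw [hx', D.map_zero]; simp
  refine le_antisymm ?_ (hD.le_adjoint hd)
  have hmem : ∀ y : (adjoint D).domain, ∃ x : D.domain, (x : E) = y ∧ D x = adjoint D y := by
    intro y
    obtain ⟨x, hx⟩ := h₁ (adjoint D y - Complex.I • (y : E))
    have hxy : (y : E) = x := by
      refine ext_inner_right ℂ fun u => ?_
      obtain ⟨v, rfl⟩ := h₂ u
      rw [← key, hx, inner_sub_left, inner_sub_right, adjoint_isFormalAdjoint hd y v,
        inner_smul_left, inner_smul_right, Complex.conj_I]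
    refine ⟨x, hxy.symm, ?_⟩
    rw [hxy] at hx
    exact sub_left_injective hx
  refine ⟨fun y hy => ?_, fun y x hyx => ?_⟩
  · obtain ⟨x, hx, -⟩ := hmem ⟨y, hy⟩
    have := x.2
    rwa [hx] at this
  · obtain ⟨x', hx', e⟩ := hmem y
    have hxx : x' = x := Subtype.ext (hx'.trans hyx)
    exact (hxx ▸ e).symm

end LinearPMap

namespace SpectralData

variable {H : Type*} [NormedAddCommGroup H] [InnerProductSpace ℂ H]

section Pairs

variable (H)

/-- Inclusion of the first component. -/
def pairInl : H →L[ℂ] WithLp 2 (H × H) :=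
  (WithLp.prodContinuousLinearEquiv 2 ℂ H H).symm.toContinuousLinearMap ∘L
    ContinuousLinearMap.inl ℂ H H

/-- Inclusion of the second component. -/
def pairInr : H →L[ℂ] WithLp 2 (H × H) :=
  (WithLp.prodContinuousLinearEquiv 2 ℂ H H).symm.toContinuousLinearMap ∘L
    ContinuousLinearMap.inr ℂ H H

end Pairs

theorem pairInl_apply (x : H) : pairInl H x = WithLp.toLp 2 (x, 0) := rfl

theorem pairInr_apply (x : H) : pairInr H x = WithLp.toLp 2 (0, x) := rfl

theorem pair_ext {V : Type*} {v w : WithLp 2 (V × V)} (h₁ : v.fst = w.fst) (h₂ : v.snd = w.snd) :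
    v = w :=
  WithLp.ofLp_injective 2 (Prod.ext h₁ h₂)

theorem pairInl_add_pairInr (v : WithLp 2 (H × H)) : pairInl H v.fst + pairInr H v.snd = v :=
  pair_ext (add_zero v.fst) (zero_add v.snd)

theorem isCompactOperator_of_pair {E : Type*} [NormedAddCommGroup E] [NormedSpace ℂ E]
    {S : E →L[ℂ] WithLp 2 (H × H)} (h₁ : IsCompactOperator fun y => (S y).fst)
    (h₂ : IsCompactOperator fun y => (S y).snd) : IsCompactOperator S := by
  have := (h₁.clm_comp (pairInl H)).add (h₂.clm_comp (pairInr H))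
  rwa [show (pairInl H ∘ fun y => (S y).fst) + (pairInr H ∘ fun y => (S y).snd) = S from
    funext fun y => pairInl_add_pairInr (S y)] at this

variable {D : H →ₗ.[ℂ] H}

theorem diracBlock_fst (n : ℤ) (v : (diracBlock D n).domain) :
    (diracBlock D n v).fst = D ⟨v.1.snd, v.2.2⟩ - (Complex.I * n) • v.1.snd := rfl

theorem diracBlock_snd (n : ℤ) (v : (diracBlock D n).domain) :
    (diracBlock D n v).snd = D ⟨v.1.fst, v.2.1⟩ + (Complex.I * n) • v.1.fst := rfl

theorem isFormalAdjoint_diracBlock (hD : D.IsFormalAdjoint D) (n : ℤ) :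
    (diracBlock D n).IsFormalAdjoint (diracBlock D n) := fun v w => by
  rw [WithLp.prod_inner_apply, WithLp.prod_inner_apply]
  change inner ℂ (D ⟨v.1.snd, v.2.2⟩ - (Complex.I * n) • v.1.snd) w.1.fst +
    inner ℂ (D ⟨v.1.fst, v.2.1⟩ + (Complex.I * n) • v.1.fst) w.1.snd =
    inner ℂ v.1.fst (D ⟨w.1.snd, w.2.2⟩ - (Complex.I * n) • w.1.snd) +
    inner ℂ v.1.snd (D ⟨w.1.fst, w.2.1⟩ + (Complex.I * n) • w.1.fst)
  rw [inner_sub_left, inner_add_left, inner_sub_right, inner_add_right, inner_smul_left,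
    inner_smul_left, inner_smul_right, inner_smul_right]
  have h1 := hD ⟨v.1.snd, v.2.2⟩ ⟨w.1.fst, w.2.1⟩
  have h2 := hD ⟨v.1.fst, v.2.1⟩ ⟨w.1.snd, w.2.2⟩
  simp only at h1 h2
  rw [h1, h2]
  simp
  ring

theorem norm_diracBlock_sq (hD : D.IsFormalAdjoint D) (n : ℤ) (v : (diracBlock D n).domain) :
    ‖diracBlock D n v‖ ^ 2 = ‖D ⟨v.1.fst, v.2.1⟩‖ ^ 2 + ‖D ⟨v.1.snd, v.2.2⟩‖ ^ 2 +
      n ^ 2 * ‖(v : WithLp 2 (H × H))‖ ^ 2 := by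
  rw [WithLp.prod_norm_sq_eq_of_L2, WithLp.prod_norm_sq_eq_of_L2, diracBlock_fst, diracBlock_snd]
  have h1 := hD.norm_sub_smul_sq n ⟨v.1.snd, v.2.2⟩
  have h2 := hD.norm_sub_smul_sq (-n) ⟨v.1.fst, v.2.1⟩
  simp only [Complex.ofReal_neg, neg_mul, neg_smul, sub_neg_eq_add, Complex.ofReal_intCast,
    mul_comm (n : ℂ), even_two, Even.neg_pow] at h1 h2
  rw [h1, h2]
  ring

theorem mul_norm_le_diracBlock_sub (hD : D.IsFormalAdjoint D) (n : ℤ) {t : ℝ} (ht : t ^ 2 = 1)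
    (v : (diracBlock D n).domain) : √(n ^ 2 + 1) * ‖(v : WithLp 2 (H × H))‖ ≤
      ‖diracBlock D n v - (t * Complex.I) • (v : WithLp 2 (H × H))‖ := by
  refine le_of_sq_le_sq ?_ (norm_nonneg _)
  rw [(isFormalAdjoint_diracBlock hD n).norm_sub_smul_sq, norm_diracBlock_sq hD, mul_pow,
    Real.sq_sqrt (by positivity), ht]
  nlinarith [sq_nonneg ‖D ⟨v.1.fst, v.2.1⟩‖, sq_nonneg ‖D ⟨v.1.snd, v.2.2⟩‖]

theorem isCompactOperator_diracBlock_resolvent {z w : ℂ} {S : H →L[ℂ] H}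
    (hS : ∀ x : D.domain, S (D x - z • (x : H)) = x) (hc : IsCompactOperator S) {n : ℤ}
    {R : WithLp 2 (H × H) →L[ℂ] WithLp 2 (H × H)} (hR : (diracBlock D n).IsResolvent w R) :
    IsCompactOperator R := by
  refine isCompactOperator_of_pair ?_ ?_
  · have e : (fun y => (R y).fst) = fun y => S ((WithLp.sndL 2 ℂ H H -
        (Complex.I * n + z) • (WithLp.fstL 2 ℂ H H ∘L R) + w • (WithLp.sndL 2 ℂ H H ∘L R)) y) := by
      funext y
      obtain ⟨h, e⟩ := hR.1 y
      have h1 : D ⟨(R y).fst, h.1⟩ + (Complex.I * n) • (R y).fst - w • (R y).snd = y.snd :=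
        congrArg WithLp.snd e
      have h2 := hS ⟨(R y).fst, h.1⟩
      refine h2.symm.trans (congrArg S ?_)
      change _ = y.snd - (Complex.I * n + z) • (R y).fst + w • (R y).snd
      rw [← h1]
      module
    rw [e]
    exact hc.comp_clm _
  · have e : (fun y => (R y).snd) = fun y => S ((WithLp.fstL 2 ℂ H H +
        (Complex.I * n - z) • (WithLp.sndL 2 ℂ H H ∘L R) + w • (WithLp.fstL 2 ℂ H H ∘L R)) y) := by
      funext y
      obtain ⟨h, e⟩ := hR.1 y
      have h1 : D ⟨(R y).snd, h.2⟩ - (Complex.I * n) • (R y).snd - w • (R y).fst = y.fst :=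
        congrArg WithLp.fst e
      have h2 := hS ⟨(R y).snd, h.2⟩
      refine h2.symm.trans (congrArg S ?_)
      change _ = y.fst + (Complex.I * n - z) • (R y).snd + w • (R y).fst
      rw [← h1]
      module
    rw [e]
    exact hc.comp_clm _

variable [CompleteSpace H]

theorem exists_sq_add_smul_eq (hD : IsSelfAdjoint D) {μ : ℝ} (hμ : μ ≠ 0) (y : H) :
    ∃ (z : H) (h : z ∈ D.domain) (h' : D ⟨z, h⟩ ∈ D.domain),
      D ⟨D ⟨z, h⟩, h'⟩ + ((μ : ℂ) ^ 2) • z = y := by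
  obtain ⟨x, hx⟩ := hD.sub_smul_surjective hμ y
  obtain ⟨z, hz⟩ := hD.sub_smul_surjective (neg_ne_zero.mpr hμ) (x : H)
  have h' : D z ∈ D.domain := by
    rw [eq_add_of_sub_eq hz]
    exact D.domain.add_mem x.2 (D.domain.smul_mem _ z.2)
  refine ⟨z, z.2, h', ?_⟩
  have e : (⟨D z, h'⟩ : D.domain) = x + (((-μ : ℝ) : ℂ) * Complex.I) • z :=
    Subtype.ext (eq_add_of_sub_eq hz)
  change D ⟨D z, h'⟩ + _ = _
  rw [e, D.map_add, D.map_smul, ← hx, ← hz]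
  push_cast
  match_scalars
  · ring
  · ring
  · linear_combination (μ : ℂ) ^ 2 * Complex.I_sq

theorem diracBlock_sub_surjective (hD : IsSelfAdjoint D) (n : ℤ) {t : ℝ} (ht : t ^ 2 = 1)
    (y : WithLp 2 (H × H)) : ∃ x : (diracBlock D n).domain,
      diracBlock D n x - (t * Complex.I) • (x : WithLp 2 (H × H)) = y := by
  have hμ : √((n : ℝ) ^ 2 + 1) ≠ 0 := (Real.sqrt_pos.mpr (by positivity)).ne'
  have hμ2 : ((√((n : ℝ) ^ 2 + 1) : ℝ) : ℂ) ^ 2 = (n : ℂ) ^ 2 + 1 := by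
    rw [← Complex.ofReal_pow, Real.sq_sqrt (by positivity)]; push_cast; rfl
  obtain ⟨p, hp, hp', ep⟩ := exists_sq_add_smul_eq hD hμ y.fst
  obtain ⟨q, hq, hq', eq⟩ := exists_sq_add_smul_eq hD hμ y.snd
  rw [hμ2] at ep eq
  set w : ℂ := t * Complex.I with hw
  have hw2 : w * w = -1 := by
    have : (t : ℂ) ^ 2 = 1 := by exact_mod_cast ht
    rw [hw]; linear_combination (t : ℂ) ^ 2 * Complex.I_sq - this
  let P : D.domain := ⟨p, hp⟩
  let Q : D.domain := ⟨q, hq⟩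
  let x₁ : D.domain := ⟨D Q, hq'⟩ - (Complex.I * n) • Q + w • P
  let x₂ : D.domain := ⟨D P, hp'⟩ + (Complex.I * n) • P + w • Q
  refine ⟨⟨WithLp.toLp 2 ((x₁ : H), (x₂ : H)), x₁.2, x₂.2⟩, pair_ext ?_ ?_⟩
  · change D x₂ - (Complex.I * n) • (x₂ : H) - w • (x₁ : H) = y.fst
    simp only [x₁, x₂, D.map_add, D.map_smul, Submodule.coe_add, Submodule.coe_sub,
      Submodule.coe_smul]
    rw [← ep]
    simp only [P, Q]
    match_scalars <;> first | ring1 | linear_combination -hw2 - (n : ℂ) ^ 2 * Complex.I_sq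
  · change D x₁ + (Complex.I * n) • (x₁ : H) - w • (x₂ : H) = y.snd
    simp only [x₁, x₂, D.map_add, D.map_sub, D.map_smul, Submodule.coe_add, Submodule.coe_sub,
      Submodule.coe_smul]
    rw [← eq]
    simp only [P, Q]
    match_scalars <;> first | ring1 | linear_combination -hw2 - (n : ℂ) ^ 2 * Complex.I_sq

theorem exists_isResolvent_diracBlock (hD : IsSelfAdjoint D) (n : ℤ) {t : ℝ} (ht : t ^ 2 = 1) :
    ∃ R : WithLp 2 (H × H) →L[ℂ] WithLp 2 (H × H),
      (diracBlock D n).IsResolvent (t * Complex.I) R ∧ ‖R‖ ≤ (√((n : ℝ) ^ 2 + 1))⁻¹ :=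
  LinearPMap.exists_isResolvent _ (Real.sqrt_pos.mpr (by positivity))
    (mul_norm_le_diracBlock_sub hD.isFormalAdjoint n ht) (diracBlock_sub_surjective hD n ht)

end SpectralData

namespace LinearPMap

variable {E : Type*} [NormedAddCommGroup E] [InnerProductSpace ℂ E] {T : ℤ → E →ₗ.[ℂ] E}

theorem isFormalAdjoint_l2Sum (hT : ∀ n, (T n).IsFormalAdjoint (T n)) :
    (l2Sum T).IsFormalAdjoint (l2Sum T) := fun f g => by
  rw [lp.inner_eq_tsum, lp.inner_eq_tsum]
  exact tsum_congr fun n => hT n ⟨f.1 n, f.2.1 n⟩ ⟨g.1 n, g.2.1 n⟩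

theorem isResolvent_l2Sum {w : ℂ} {R : ℤ → E →L[ℂ] E} (hR : ∀ n, (T n).IsResolvent w (R n)) {K : ℝ}
    (hK : 0 ≤ K) (hRK : ∀ n, ‖R n‖ ≤ K) :
    (l2Sum T).IsResolvent w (lp.mapCLM 2 R hK hRK) := by
  refine ⟨fun y => ?_, fun x => lp.ext (funext fun n => (hR n).2 ⟨x.1 n, x.2.1 n⟩)⟩
  have hd : lp.mapCLM 2 R hK hRK y ∈ (l2Sum T).domain := by
    refine ⟨fun n => ((hR n).1 (y n)).1, ?_⟩
    convert lp.memℓp (y + w • lp.mapCLM 2 R hK hRK y) using 1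
    exact funext fun n => eq_add_of_sub_eq ((hR n).1 (y n)).2
  exact ⟨hd, lp.ext (funext fun n => ((hR n).1 (y n)).2)⟩

theorem isCompactOperator_mapCLM [CompleteSpace E] {R : ℤ → E →L[ℂ] E} {K : ℝ} (hK : 0 ≤ K)
    (hRK : ∀ n, ‖R n‖ ≤ K) (hc : ∀ n, IsCompactOperator (R n)) {c : ℕ → ℝ} (hc0 : ∀ N, 0 ≤ c N)
    (hlim : Filter.Tendsto c Filter.atTop (nhds 0))
    (hRc : ∀ (N : ℕ) (n : ℤ), N < n.natAbs → ‖R n‖ ≤ c N) :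
    IsCompactOperator (lp.mapCLM (E := fun _ : ℤ => E) (F := fun _ : ℤ => E) 2 R hK hRK) := by
  let F : ℕ → lp (fun _ : ℤ => E) 2 →L[ℂ] lp (fun _ : ℤ => E) 2 := fun N =>
    ∑ n ∈ Finset.Icc (-N : ℤ) N, lp.singleContinuousLinearMap ℂ (fun _ : ℤ => E) 2 n ∘L R n ∘L
      lp.evalCLM ℂ (fun _ : ℤ => E) 2 n
  have hF : ∀ N f m, F N f m = if m.natAbs ≤ N then R m (f m) else 0 := by
    intro N f m
    simp only [F, sum_apply, ContinuousLinearMap.comp_apply,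
      lp.singleContinuousLinearMap_apply, lp.coeFn_sum, Finset.sum_apply, lp.single_apply,
      Finset.sum_pi_single, Finset.mem_Icc]
    have : (-(N : ℤ) ≤ m ∧ m ≤ N) ↔ m.natAbs ≤ N := by omega
    simp only [this]
    rfl
  have hle : ∀ N, ‖F N - lp.mapCLM 2 R hK hRK‖ ≤ c N := by
    intro N
    let T : ℤ → E →L[ℂ] E := fun n => if n.natAbs ≤ N then 0 else -R n
    have hT : ∀ n, ‖T n‖ ≤ c N := fun n => by
      simp only [T]
      split_ifs with h
      · simpa using hc0 N
      · rw [norm_neg]; exact hRc N n (not_le.mp h)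
    have e : F N - lp.mapCLM 2 R hK hRK = lp.mapCLM 2 T (hc0 N) hT := by
      refine ContinuousLinearMap.ext fun f => lp.ext (funext fun n => ?_)
      change F N f n - R n (f n) = T n (f n)
      rw [hF]
      simp only [T]
      split_ifs <;> simp
    rw [e]
    exact lp.norm_mapCLM_le 2 T (hc0 N) hT
  refine isCompactOperator_of_tendsto (l := Filter.atTop) (F := F)
    (tendsto_iff_norm_sub_tendsto_zero.mpr
      (squeeze_zero (fun _ => norm_nonneg _) hle hlim)) (Filter.Eventually.of_forall fun N => ?_)
  refine Submodule.sum_mem (compactOperator (RingHom.id ℂ) (lp (fun _ : ℤ => E) 2)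
    (lp (fun _ : ℤ => E) 2)) (t := Finset.Icc (-N : ℤ) N) (f := fun n =>
      ((lp.singleContinuousLinearMap ℂ (fun _ : ℤ => E) 2 n ∘L R n ∘L
        lp.evalCLM ℂ (fun _ : ℤ => E) 2 n : lp (fun _ : ℤ => E) 2 →L[ℂ] lp (fun _ : ℤ => E) 2))) fun n _ => ?_
  exact ((hc n).comp_clm (lp.evalCLM ℂ (fun _ : ℤ => E) 2 n)).clm_comp
    (lp.singleContinuousLinearMap ℂ (fun _ : ℤ => E) 2 n)

end LinearPMap

namespace SpectralData

variable {H : Type*} [NormedAddCommGroup H] [InnerProductSpace ℂ H] [CompleteSpace H]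
  {D : H →ₗ.[ℂ] H}

theorem exists_isResolvent_l2Sum_diracBlock (hD : IsSelfAdjoint D) {t : ℝ} (ht : t ^ 2 = 1) :
    ∃ R, (LinearPMap.l2Sum (diracBlock D)).IsResolvent (t * Complex.I) R ∧
      (HasCompactResolvent D → IsCompactOperator R) := by
  choose R hR hle using fun n => exists_isResolvent_diracBlock hD n ht
  have hR1 : ∀ n, ‖R n‖ ≤ 1 := fun n => (hle n).trans (inv_le_one_of_one_le₀
    (Real.one_le_sqrt.mpr (by nlinarith [sq_nonneg (n : ℝ)])))
  refine ⟨_, LinearPMap.isResolvent_l2Sum hR zero_le_one hR1, ?_⟩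
  rintro ⟨z, S, hS, -, hS'⟩
  refine LinearPMap.isCompactOperator_mapCLM _ hR1
    (fun n => isCompactOperator_diracBlock_resolvent hS' hS (hR n))
    (c := fun N => ((N : ℝ) + 1)⁻¹) (fun N => by positivity) ?_ fun N n hn => (hle n).trans ?_
  · simpa using tendsto_one_div_add_atTop_nhds_zero_nat (𝕜 := ℝ)
  · refine inv_anti₀ (by positivity) (Real.le_sqrt_of_sq_le ?_)
    have h1 : ((N : ℝ) + 1) ≤ |(n : ℝ)| := by
      rw [← Int.cast_abs, Int.abs_eq_natAbs]
      exact_mod_cast hn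
    nlinarith [sq_abs (n : ℝ), (Nat.cast_nonneg N : (0 : ℝ) ≤ N)]

theorem isSelfAdjoint_l2Sum_diracBlock (hD : IsSelfAdjoint D) :
    IsSelfAdjoint (LinearPMap.l2Sum (diracBlock D)) := by
  obtain ⟨R, hR, -⟩ := exists_isResolvent_l2Sum_diracBlock hD (t := 1) (by norm_num)
  obtain ⟨S, hS, -⟩ := exists_isResolvent_l2Sum_diracBlock hD (t := -1) (by norm_num)
  refine (LinearPMap.isFormalAdjoint_l2Sum fun n =>
    isFormalAdjoint_diracBlock hD.isFormalAdjoint n).isSelfAdjoint (fun y => ?_) fun y => ?_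
  · obtain ⟨h, e⟩ := hR.1 y
    exact ⟨⟨R y, h⟩, by simpa using e⟩
  · obtain ⟨h, e⟩ := hS.1 y
    exact ⟨⟨S y, h⟩, by simpa using e⟩

theorem hasCompactResolvent_l2Sum_diracBlock (hD : IsSelfAdjoint D) (hc : HasCompactResolvent D) :
    HasCompactResolvent (LinearPMap.l2Sum (diracBlock D)) :=
  let ⟨R, hR, hR'⟩ := exists_isResolvent_l2Sum_diracBlock hD (t := 1) (by norm_num)
  ⟨_, R, hR' hc, hR⟩

end SpectralData

section Commutators

variable {E : Type*} [NormedAddCommGroup E] [InnerProductSpace ℂ E] {D : E →ₗ.[ℂ] E}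

theorem isCommutator_zero : IsCommutator D 0 0 := fun x => by
  refine ⟨D.domain.zero_mem, ?_⟩
  change D 0 - 0 = 0
  rw [D.map_zero, sub_zero]

theorem IsCommutator.add {b c S T : E →L[ℂ] E} (hb : IsCommutator D b S)
    (hc : IsCommutator D c T) : IsCommutator D (b + c) (S + T) := fun x => by
  obtain ⟨h₁, e₁⟩ := hb x
  obtain ⟨h₂, e₂⟩ := hc x
  refine ⟨D.domain.add_mem h₁ h₂, ?_⟩
  change D (⟨b x, h₁⟩ + ⟨c x, h₂⟩) - (b (D x) + c (D x)) = S x + T x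
  rw [D.map_add, ← e₁, ← e₂]
  abel

theorem IsCommutator.smul {b T : E →L[ℂ] E} (hb : IsCommutator D b T) (c : ℂ) :
    IsCommutator D (c • b) (c • T) := fun x => by
  obtain ⟨h, e⟩ := hb x
  refine ⟨D.domain.smul_mem c h, ?_⟩
  change D (c • ⟨b x, h⟩) - c • b (D x) = c • T x
  rw [D.map_smul, ← e, smul_sub]

theorem isCommutator_one : IsCommutator D 1 0 := fun x => ⟨x.2, sub_self (D x)⟩

variable [CompleteSpace E]

/-- A bounded linear map on a dense subspace extends with the same bound. -/
theorem exists_extension_of_dense {p : Submodule ℂ E} (hp : Dense (p : Set E)) (T : p →ₗ[ℂ] E)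
    {C : ℝ} (hC : 0 ≤ C) (hT : ∀ x, ‖T x‖ ≤ C * ‖(x : E)‖) :
    ∃ S : E →L[ℂ] E, (∀ x : p, S x = T x) ∧ ‖S‖ ≤ C := by
  have e := (T.mkContinuous C hT).extend_eq (e := p.subtypeL) hp.denseRange_val
    isUniformEmbedding_subtype_val.isUniformInducing
  refine ⟨(T.mkContinuous C hT).extend p.subtypeL, e, ?_⟩
  refine ContinuousLinearMap.opNorm_le_bound _ hC fun x => ?_
  refine hp.denseRange_val.induction_on (p := fun x => ‖_‖ ≤ C * ‖x‖) x
    (isClosed_le (by fun_prop) (by fun_prop)) fun y => ?_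
  exact (congrArg norm (e y)).trans_le (hT y)

/-- A weak form of the boundedness of the commutator, closed in `b`. -/
theorem IsSelfAdjoint.exists_isCommutator_iff (hD : IsSelfAdjoint D) {C : ℝ} (hC : 0 ≤ C)
    (b : E →L[ℂ] E) : (∃ T, IsCommutator D b T ∧ ‖T‖ ≤ C) ↔ ∀ f g : D.domain,
      ‖inner ℂ (b f) (D g) - inner ℂ (b (D f)) (g : E)‖ ≤ C * ‖(f : E)‖ * ‖(g : E)‖ := by
  have hS := hD.isFormalAdjoint
  have hd := hD.dense_domain
  constructor
  · rintro ⟨T, hT, hle⟩ f g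
    obtain ⟨h, e⟩ := hT f
    have h1 := hS ⟨b f, h⟩ g
    simp only at h1
    rw [← h1, ← inner_sub_left, e]
    exact (norm_inner_le_norm _ _).trans
      (mul_le_mul_of_nonneg_right (T.le_of_opNorm_le hle f) (norm_nonneg _))
  · intro h
    have hmem : ∀ f : D.domain, b f ∈ D.domain := by
      intro f
      have h1 : b f ∈ (LinearPMap.adjoint D).domain := by
        rw [LinearPMap.mem_adjoint_domain_iff]
        let L : D.domain →ₗ[ℂ] ℂ := (innerₛₗ ℂ (b f)).comp D.toFun -
          (innerₛₗ ℂ (b (D f))).comp D.domain.subtype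
        have hL : Continuous L := (L.mkContinuous (C * ‖(f : E)‖) (h f)).continuous
        have h2 : Continuous fun g : D.domain => inner ℂ (b (D f)) (g : E) := by fun_prop
        refine (hL.add h2).congr fun g => ?_
        exact sub_add_cancel _ _
      rwa [LinearPMap.isSelfAdjoint_def.mp hD] at h1
    let T : D.domain →ₗ[ℂ] E :=
      { toFun := fun f => D ⟨b f, hmem f⟩ - b (D f)
        map_add' := fun f g => by
          have : (⟨b ((f + g : D.domain) : E), hmem _⟩ : D.domain) =
            ⟨b f, hmem f⟩ + ⟨b g, hmem g⟩ := Subtype.ext (map_add b _ _)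
          rw [this, D.map_add, D.map_add, map_add]
          abel
        map_smul' := fun c f => by
          have : (⟨b ((c • f : D.domain) : E), hmem _⟩ : D.domain) =
            c • ⟨b f, hmem f⟩ := Subtype.ext (map_smul b _ _)
          rw [this, D.map_smul, D.map_smul, map_smul, RingHom.id_apply, smul_sub] }
    have hT : ∀ f, ‖T f‖ ≤ C * ‖(f : E)‖ := by
      intro f
      have h1 : ∀ v : E, ‖inner ℂ (T f) v‖ ≤ C * ‖(f : E)‖ * ‖v‖ := fun v => by
        refine hd.denseRange_val.induction_on
          (p := fun v => ‖inner ℂ (T f) v‖ ≤ C * ‖(f : E)‖ * ‖v‖) v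
          (isClosed_le (by fun_prop) (by fun_prop)) fun g => ?_
        have h2 := h f g
        have h3 := hS ⟨b f, hmem f⟩ g
        simp only at h3
        rwa [← h3, ← inner_sub_left] at h2
      have h4 := h1 (T f)
      rw [inner_self_eq_norm_sq_to_K, norm_pow, RCLike.norm_ofReal, abs_norm, sq] at h4
      rcases (norm_nonneg (T f)).eq_or_lt with h0 | h0
      · rw [← h0]; positivity
      · exact le_of_mul_le_mul_right h4 h0
    obtain ⟨S, hS, hle⟩ := exists_extension_of_dense hd T hC hT
    exact ⟨S, fun f => ⟨hmem f, (hS f).symm⟩, hle⟩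

end Commutators

namespace SpectralData

variable {A : Type*} [CStarAlgebra A] {H : Type*} [NormedAddCommGroup H]
  [InnerProductSpace ℂ H] [CompleteSpace H] (X : SpectralData A H)

theorem continuous_rep : Continuous X.rep :=
  AddMonoidHomClass.continuous_of_bound X.rep 1 fun a => by
    rw [one_mul]; exact NonUnitalStarAlgHom.norm_apply_le X.rep a

theorem isClosed_lipBall (hD : IsSelfAdjoint X.dirac) : IsClosed X.lipBall := by
  have h : X.lipBall = ⋂ (f : X.dirac.domain) (g : X.dirac.domain),
      {a | ‖inner ℂ (X.rep a f) (X.dirac g) - inner ℂ (X.rep a (X.dirac f)) (g : H)‖ ≤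
        1 * ‖(f : H)‖ * ‖(g : H)‖} := by
    ext a
    simp only [Set.mem_iInter]
    exact hD.exists_isCommutator_iff zero_le_one (X.rep a)
  rw [h]
  have := X.continuous_rep
  exact isClosed_iInter fun f => isClosed_iInter fun g =>
    isClosed_le (by fun_prop) continuous_const

/-- `C¹(X)` as a linear subspace. -/
def C1Submodule : Submodule ℂ A where
  carrier := X.C1
  zero_mem' := ⟨0, by rw [map_zero]; exact isCommutator_zero⟩
  add_mem' := by
    rintro a b ⟨S, hS⟩ ⟨T, hT⟩
    exact ⟨S + T, by rw [map_add]; exact hS.add hT⟩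
  smul_mem' := by
    rintro c a ⟨T, hT⟩
    exact ⟨c • T, by rw [map_smul]; exact hT.smul c⟩

theorem add_mem_lipBall {a b : A} (ha : a ∈ X.lipBall) (hb : b ∈ X.commutant) :
    a + b ∈ X.lipBall := by
  obtain ⟨T, hT, hle⟩ := ha
  refine ⟨T, ?_, hle⟩
  rw [map_add, ← add_zero T]
  exact hT.add hb

theorem mem_lipBall_of_mem_commutant {a : A} (ha : a ∈ X.commutant) : a ∈ X.lipBall :=
  ⟨0, ha, by simp⟩

theorem rep_one (hX : (Submodule.span ℂ {y : H | ∃ a x, X.rep a x = y}).topologicalClosure = ⊤) :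
    X.rep 1 = 1 := by
  have h1 : (Submodule.span ℂ {y : H | ∃ a x, X.rep a x = y}).topologicalClosure ≤
      LinearMap.eqLocus (X.rep 1 : H →ₗ[ℂ] H) LinearMap.id := by
    refine Submodule.topologicalClosure_minimal _ (Submodule.span_le.mpr ?_)
      (isClosed_eq (X.rep 1).continuous continuous_id)
    rintro _ ⟨a, x, rfl⟩
    change X.rep 1 (X.rep a x) = X.rep a x
    rw [← mul_apply_eq_comp, ← map_mul, one_mul]
  rw [hX] at h1
  exact ContinuousLinearMap.ext fun y => h1 (Submodule.mem_top (x := y))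

theorem mkQ_preimage_image_lipBall :
    X.commutant.mkQ ⁻¹' (X.commutant.mkQ '' X.lipBall) = X.lipBall := by
  refine subset_antisymm ?_ (Set.subset_preimage_image _ _)
  rintro a ⟨b, hb, hab⟩
  have h : a - b ∈ X.commutant := by
    rw [← Submodule.Quotient.mk_eq_zero, Submodule.Quotient.mk_sub, sub_eq_zero]
    exact hab.symm
  have := X.add_mem_lipBall hb h
  rwa [add_sub_cancel] at this

theorem isClosed_image_lipBall (hD : IsSelfAdjoint X.dirac) :
    IsClosed (X.commutant.mkQ '' X.lipBall) := by
  rw [← X.commutant.isOpenQuotientMap_mkQ.isQuotientMap.isClosed_preimage]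
  rw [X.mkQ_preimage_image_lipBall]
  exact X.isClosed_lipBall hD

end SpectralData

section Schur

variable {E : Type*} [NormedAddCommGroup E] [InnerProductSpace ℂ E]

/-- Two bounded operators on `ℓ²(ℤ, E)` with the same matrix coefficients are equal. -/
theorem clm_eq_of_lp_single {F : Type*} [NormedAddCommGroup F] [NormedSpace ℂ F]
    {S T : lp (fun _ : ℤ => E) 2 →L[ℂ] F}
    (h : ∀ m v, S (lp.single 2 m v) = T (lp.single 2 m v)) : S = T :=
  lp.ext_continuousLinearMap (by norm_num) fun m => ContinuousLinearMap.ext (h m)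

/-- Multiplying the matrix coefficients of `S` by a Toeplitz symbol `c` of `ℓ²`-norm at most `γ`
gives an operator of norm at most `γ ‖S‖`. -/
theorem norm_le_of_toeplitz_multiplier {S V : lp (fun _ : ℤ => E) 2 →L[ℂ] lp (fun _ : ℤ => E) 2}
    {c : ℤ → ℂ} {γ : ℝ} (hγ : 0 ≤ γ) (hc : ∀ s : Finset ℤ, ∑ k ∈ s, ‖c k‖ ^ 2 ≤ γ ^ 2)
    (hV : ∀ m v n, V (lp.single 2 m v) n = c (n - m) • S (lp.single 2 m v) n) :
    ‖V‖ ≤ γ * ‖S‖ := by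
  have hck : ∀ k, ‖c k‖ ≤ γ := fun k =>
    le_of_sq_le_sq (by simpa using hc {k}) hγ
  have hcid : ∀ n m : ℤ, ‖c (n - m) • ContinuousLinearMap.id ℂ E‖ ≤ γ := fun n m => by
    refine ContinuousLinearMap.opNorm_le_bound _ hγ fun x => ?_
    change ‖c (n - m) • x‖ ≤ _
    rw [norm_smul]
    exact mul_le_mul_of_nonneg_right (hck _) (norm_nonneg x)
  let G : ℤ → lp (fun _ : ℤ => E) 2 →L[ℂ] lp (fun _ : ℤ => E) 2 := fun n =>
    lp.mapCLM (E := fun _ : ℤ => E) (F := fun _ : ℤ => E) 2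
      (fun m => c (n - m) • ContinuousLinearMap.id ℂ E) hγ (hcid n)
  have hG : ∀ n f m, G n f m = c (n - m) • f m := fun _ _ _ => rfl
  have hGs : ∀ n m v, G n (lp.single 2 m v) = c (n - m) • lp.single 2 m v := fun n m v => by
    refine lp.ext (funext fun k => ?_)
    rw [hG, lp.coeFn_smul, Pi.smul_apply]
    by_cases h : k = m
    · rw [h]
    · rw [lp.single_apply_ne _ _ _ h, smul_zero, smul_zero]
  have key : ∀ n f, V f n = S (G n f) n := by
    intro n f
    have : lp.evalCLM ℂ (fun _ : ℤ => E) 2 n ∘L V =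
        lp.evalCLM ℂ (fun _ : ℤ => E) 2 n ∘L S ∘L G n := by
      refine clm_eq_of_lp_single fun m v => ?_
      change V _ n = S (G n _) n
      rw [hV, hGs, map_smul, lp.coeFn_smul, Pi.smul_apply]
    exact congrArg (fun L => L f) this
  have hsq : ∀ f : lp (fun _ : ℤ => E) 2, HasSum (fun m => ‖f m‖ ^ 2) (‖f‖ ^ 2) := fun f => by
    have := lp.hasSum_norm (p := 2) (by norm_num) f
    simpa using this
  refine ContinuousLinearMap.opNorm_le_bound _ (by positivity) fun f => ?_
  refine lp.norm_le_of_forall_sum_le (by norm_num) (by positivity) fun s => ?_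
  simp only [ENNReal.toReal_ofNat, Real.rpow_ofNat]
  have h1 : ∀ n, ‖V f n‖ ^ 2 ≤ ‖S‖ ^ 2 * ∑' m, ‖c (n - m)‖ ^ 2 * ‖f m‖ ^ 2 := fun n => by
    have h2 := (hsq (G n f)).tsum_eq
    simp only [hG, norm_smul, mul_pow] at h2
    rw [h2, key, ← mul_pow]
    gcongr
    exact (lp.norm_apply_le_norm (by norm_num) _ _).trans (S.le_opNorm _)
  have hsum : ∀ n, Summable fun m => ‖c (n - m)‖ ^ 2 * ‖f m‖ ^ 2 := fun n => by
    have := (hsq (G n f)).summable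
    simpa only [hG, norm_smul, mul_pow] using this
  calc ∑ n ∈ s, ‖V f n‖ ^ 2 ≤ ∑ n ∈ s, ‖S‖ ^ 2 * ∑' m, ‖c (n - m)‖ ^ 2 * ‖f m‖ ^ 2 :=
        Finset.sum_le_sum fun n _ => h1 n
    _ = ‖S‖ ^ 2 * ∑' m, (∑ n ∈ s, ‖c (n - m)‖ ^ 2) * ‖f m‖ ^ 2 := by
        rw [← Finset.mul_sum, ← Summable.tsum_finsetSum fun n _ => hsum n]
        simp only [Finset.sum_mul]
    _ ≤ ‖S‖ ^ 2 * ∑' m, γ ^ 2 * ‖f m‖ ^ 2 := by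
        gcongr with m
        · simp only [Finset.sum_mul]
          exact summable_sum fun n _ => hsum n
        · exact (hsq f).summable.mul_left _
        · have := hc (s.map (Equiv.subRight m).toEmbedding)
          rwa [Finset.sum_map] at this
    _ = (γ * ‖S‖ * ‖f‖) ^ 2 := by rw [tsum_mul_left, (hsq f).tsum_eq]; ring

/-- The tails of `∑ 1 / k²` are small. -/
theorem exists_finset_sum_inv_sq_le {ε : ℝ} (hε : 0 < ε) : ∃ s : Finset ℤ, 0 ∈ s ∧
    ∀ t : Finset ℤ, ∑ k ∈ t, ‖if k ∈ s then 0 else (k : ℂ)⁻¹‖ ^ 2 ≤ ε ^ 2 := by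
  classical
  have hs : Summable fun k : ℤ => 1 / (k : ℝ) ^ 2 :=
    Real.summable_one_div_int_pow.mpr one_lt_two
  obtain ⟨s, hs⟩ := summable_iff_vanishing_norm.mp hs (ε ^ 2) (by positivity)
  refine ⟨insert 0 s, Finset.mem_insert_self _ _, fun t => ?_⟩
  have h1 := hs (t \ insert 0 s) (by
    rw [Finset.disjoint_left]
    intro k hk hk'
    exact (Finset.mem_sdiff.mp hk).2 (Finset.mem_insert_of_mem hk'))
  refine le_trans ?_ ((le_abs_self _).trans h1.le)
  rw [Finset.sdiff_eq_filter, Finset.sum_filter]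
  refine Finset.sum_le_sum fun k _ => ?_
  split_ifs <;> simp_all

end Schur

namespace LinearPMap

variable {E : Type*} [NormedAddCommGroup E] [InnerProductSpace ℂ E] {T : ℤ → E →ₗ.[ℂ] E}

theorem exists_lp_single_mem_l2Sum (m : ℤ) (v : (T m).domain) :
    ∃ h : lp.single 2 m (v : E) ∈ (l2Sum T).domain,
      l2Sum T ⟨lp.single 2 m (v : E), h⟩ = lp.single 2 m (T m v) := by
  have hd : ∀ n, lp.single (E := fun _ : ℤ => E) 2 m (v : E) n ∈ (T n).domain := by
    intro n
    by_cases h : n = m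
    · subst h; rw [lp.single_apply_self]; exact v.2
    · rw [lp.single_apply_ne _ _ _ h]; exact (T n).domain.zero_mem
  have hv : ∀ n, T n ⟨lp.single (E := fun _ : ℤ => E) 2 m (v : E) n, hd n⟩ =
      lp.single (E := fun _ : ℤ => E) 2 m (T m v) n := by
    intro n
    by_cases h : n = m
    · subst h
      refine Eq.trans ?_ (lp.single_apply_self (E := fun _ : ℤ => E) 2 ..).symm
      exact congrArg (T n) (Subtype.ext (lp.single_apply_self (E := fun _ : ℤ => E) 2 ..))
    · refine Eq.trans ?_ (lp.single_apply_ne (E := fun _ : ℤ => E) 2 _ _ h).symm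
      have : (⟨lp.single (E := fun _ : ℤ => E) 2 m (v : E) n, hd n⟩ : (T n).domain) = 0 :=
        Subtype.ext (lp.single_apply_ne (E := fun _ : ℤ => E) 2 _ _ h)
      exact (congrArg (T n) this).trans (T n).map_zero
  refine ⟨⟨hd, ?_⟩, lp.ext (funext hv)⟩
  convert lp.memℓp (lp.single (E := fun _ : ℤ => E) 2 m (T m v)) using 1
  exact funext hv

end LinearPMap

namespace SpectralData

variable {H : Type*} [NormedAddCommGroup H] [InnerProductSpace ℂ H]

variable (H) in
/-- The flip `(x, y) ↦ (y, x)` on `H ⊕ H`. -/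
def pairSwap : WithLp 2 (H × H) →L[ℂ] WithLp 2 (H × H) :=
  pairInl H ∘L WithLp.sndL 2 ℂ H H + pairInr H ∘L WithLp.fstL 2 ℂ H H

variable (H) in
/-- The sign `(x, y) ↦ (x, -y)` on `H ⊕ H`. -/
def pairSign : WithLp 2 (H × H) →L[ℂ] WithLp 2 (H × H) :=
  pairInl H ∘L WithLp.fstL 2 ℂ H H - pairInr H ∘L WithLp.sndL 2 ℂ H H

theorem pairSwap_toLp (x y : H) : pairSwap H (WithLp.toLp 2 (x, y)) = WithLp.toLp 2 (y, x) :=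
  pair_ext (add_zero y) (zero_add x)

theorem pairSign_apply (v : WithLp 2 (H × H)) : pairSign H v = WithLp.toLp 2 (v.fst, -v.snd) :=
  pair_ext (sub_zero v.fst) (zero_sub v.snd)

/-- A constant diagonal operator on `ℓ²(ℤ, H ⊕ H)`. -/
def ampliation (T : WithLp 2 (H × H) →L[ℂ] WithLp 2 (H × H)) : RegSpace H →L[ℂ] RegSpace H :=
  lp.mapCLM 2 (fun _ : ℤ => T) (norm_nonneg T) fun _ => le_rfl

theorem ampliation_lp_single (T : WithLp 2 (H × H) →L[ℂ] WithLp 2 (H × H)) (m : ℤ)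
    (v : WithLp 2 (H × H)) : ampliation T (lp.single 2 m v) = lp.single 2 m (T v) := by
  refine lp.ext (funext fun n => ?_)
  change T (lp.single (E := fun _ : ℤ => WithLp 2 (H × H)) 2 m v n) = _
  by_cases h : n = m
  · subst h; rw [lp.single_apply_self, lp.single_apply_self]
  · rw [lp.single_apply_ne _ _ _ h, lp.single_apply_ne _ _ _ h, map_zero]

section Entries

variable {D : H →ₗ.[ℂ] H} {B T : RegSpace H →L[ℂ] RegSpace H}

/-- Matrix coefficients of a commutator with `D̂`. -/
theorem IsCommutator.entry (hT : IsCommutator (LinearPMap.l2Sum (diracBlock D)) B T) {m n : ℤ}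
    {c : H →L[ℂ] H} (hc : ∀ v, B (lp.single 2 m v) n = WithLp.toLp 2 (c v.fst, c v.snd))
    (x y : D.domain) : ∃ (hx : c x ∈ D.domain) (hy : c y ∈ D.domain),
      T (lp.single 2 m (WithLp.toLp 2 ((x : H), (y : H)))) n = WithLp.toLp 2
        (D ⟨c y, hy⟩ - c (D y) - (Complex.I * ((n : ℂ) - m)) • c y,
          D ⟨c x, hx⟩ - c (D x) + (Complex.I * ((n : ℂ) - m)) • c x) := by
  let v : (diracBlock D m).domain := ⟨WithLp.toLp 2 ((x : H), (y : H)), x.2, y.2⟩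
  obtain ⟨h, e⟩ := LinearPMap.exists_lp_single_mem_l2Sum (T := diracBlock D) m v
  obtain ⟨h', e'⟩ := hT ⟨_, h⟩
  have hn := h'.1 n
  have hw := hc v
  have e1 : diracBlock D n ⟨B (lp.single 2 m (v : WithLp 2 (H × H))) n, hn⟩ -
      B (lp.single 2 m (diracBlock D m v)) n = T (lp.single 2 m (v : WithLp 2 (H × H))) n := by
    rw [← e, ← e']; rfl
  have hn' : WithLp.toLp 2 (c x, c y) ∈ (diracBlock D n).domain := by rw [hw] at hn; exact hn
  have e2 : (⟨B (lp.single 2 m (v : WithLp 2 (H × H))) n, hn⟩ : (diracBlock D n).domain) =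
    ⟨WithLp.toLp 2 (c x, c y), hn'⟩ := Subtype.ext hw
  rw [e2, hc] at e1
  refine ⟨hn'.1, hn'.2, e1.symm.trans (pair_ext ?_ ?_)⟩
  · change D ⟨c y, hn'.2⟩ - (Complex.I * n) • c y - c (D y - (Complex.I * m) • (y : H)) =
      D ⟨c y, hn'.2⟩ - c (D y) - (Complex.I * ((n : ℂ) - m)) • c y
    rw [map_sub, map_smul]
    module
  · change D ⟨c x, hn'.1⟩ + (Complex.I * n) • c x - c (D x + (Complex.I * m) • (x : H)) =
      D ⟨c x, hn'.1⟩ - c (D x) + (Complex.I * ((n : ℂ) - m)) • c x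
    rw [map_add, map_smul]
    module

theorem IsCommutator.exists_entry (hT : IsCommutator (LinearPMap.l2Sum (diracBlock D)) B T)
    {m n : ℤ} {c : H →L[ℂ] H}
    (hc : ∀ v, B (lp.single 2 m v) n = WithLp.toLp 2 (c v.fst, c v.snd)) :
    ∃ S, IsCommutator D c S ∧ ‖S‖ ≤ ‖T‖ := by
  let ev : RegSpace H →L[ℂ] WithLp 2 (H × H) := lp.evalCLM ℂ (fun _ : ℤ => WithLp 2 (H × H)) 2 n
  let sg : WithLp 2 (H × H) →L[ℂ] RegSpace H :=
    lp.singleContinuousLinearMap ℂ (fun _ : ℤ => WithLp 2 (H × H)) 2 m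
  let W := ev ∘L T ∘L sg
  have hW : ∀ v, ‖W v‖ ≤ ‖T‖ * ‖v‖ := fun v => by
    refine (lp.norm_apply_le_norm (by norm_num) (T (sg v)) n).trans ((T.le_opNorm _).trans_eq ?_)
    rw [lp.singleContinuousLinearMap_apply, lp.norm_single (by norm_num)]
  refine ⟨(2⁻¹ : ℂ) • (WithLp.sndL 2 ℂ H H ∘L W ∘L pairInl H +
    WithLp.fstL 2 ℂ H H ∘L W ∘L pairInr H), fun x => ?_, ?_⟩
  · obtain ⟨hx, _, e1⟩ := IsCommutator.entry hT hc x 0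
    obtain ⟨_, hx', e2⟩ := IsCommutator.entry hT hc 0 x
    refine ⟨hx, ?_⟩
    change _ = (2⁻¹ : ℂ) • ((T (lp.single 2 m (WithLp.toLp 2 ((x : H), (0 : H)))) n).snd +
      (T (lp.single 2 m (WithLp.toLp 2 ((0 : H), (x : H)))) n).fst)
    have e1' : (T (lp.single 2 m (WithLp.toLp 2 ((x : H), (0 : H)))) n).snd =
      D ⟨c x, hx⟩ - c (D x) + (Complex.I * ((n : ℂ) - m)) • c x := congrArg WithLp.snd e1
    have e2' : (T (lp.single 2 m (WithLp.toLp 2 ((0 : H), (x : H)))) n).fst =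
      D ⟨c x, hx⟩ - c (D x) - (Complex.I * ((n : ℂ) - m)) • c x := congrArg WithLp.fst e2
    rw [e1', e2']
    module
  · refine ContinuousLinearMap.opNorm_le_bound _ (norm_nonneg T) fun x => ?_
    change ‖(2⁻¹ : ℂ) • ((W (pairInl H x)).snd + (W (pairInr H x)).fst)‖ ≤ _
    have h1 := (WithLp.norm_snd_le H (W (pairInl H x))).trans (hW _)
    have h2 := (WithLp.norm_fst_le H (W (pairInr H x))).trans (hW _)
    rw [pairInl_apply, WithLp.norm_toLp_fst] at h1
    rw [pairInr_apply, WithLp.norm_toLp_snd] at h2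
    rw [norm_smul, norm_inv, Complex.norm_two]
    have h3 := norm_add_le (W (pairInl H x)).snd (W (pairInr H x)).fst
    rw [pairInl_apply, pairInr_apply] at *
    linarith

/-- The commutator of `B` with the number operator `n` is bounded by that with `D̂`. -/
theorem IsCommutator.exists_number_commutator (hd : Dense (D.domain : Set H))
    (hT : IsCommutator (LinearPMap.l2Sum (diracBlock D)) B T) {c : ℤ → ℤ → H →L[ℂ] H}
    (hc : ∀ m n v, B (lp.single 2 m v) n = WithLp.toLp 2 (c m n v.fst, c m n v.snd)) :
    ∃ S : RegSpace H →L[ℂ] RegSpace H,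
      ‖S‖ ≤ 2 * ‖ampliation ((2 * Complex.I)⁻¹ • pairSign H)‖ *
        ‖ampliation (pairSwap H)‖ * ‖T‖ ∧
      ∀ m n v, S (lp.single 2 m v) n = ((n : ℂ) - m) • B (lp.single 2 m v) n := by
  let J := ampliation (pairSwap H)
  let Z := ampliation ((2 * Complex.I)⁻¹ • pairSign H)
  let S := Z ∘L (J ∘L T - T ∘L J)
  refine ⟨S, ?_, fun m n v => ?_⟩
  · have h1 := ContinuousLinearMap.opNorm_comp_le Z (J ∘L T - T ∘L J)
    have h2 := norm_sub_le (J ∘L T) (T ∘L J)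
    have h3 := ContinuousLinearMap.opNorm_comp_le J T
    have h4 := ContinuousLinearMap.opNorm_comp_le T J
    have h5 : ‖J ∘L T - T ∘L J‖ ≤ 2 * (‖J‖ * ‖T‖) := by linarith [mul_comm ‖T‖ ‖J‖]
    have h6 := mul_le_mul_of_nonneg_left h5 (norm_nonneg Z)
    change ‖S‖ ≤ 2 * ‖Z‖ * ‖J‖ * ‖T‖
    linarith
  · have hdd : DenseRange fun p : D.domain × D.domain =>
        WithLp.toLp 2 ((p.1 : H), (p.2 : H)) :=
      ((WithLp.prodContinuousLinearEquiv 2 ℂ H H).symm.surjective.denseRange).comp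
        (hd.denseRange_val.prodMap hd.denseRange_val)
        (WithLp.prodContinuousLinearEquiv 2 ℂ H H).symm.continuous
    have hcont : ∀ L : RegSpace H →L[ℂ] RegSpace H, Continuous fun v => L (lp.single 2 m v) n :=
      fun L => (lp.evalCLM ℂ (fun _ : ℤ => WithLp 2 (H × H)) 2 n ∘L L ∘L
        lp.singleContinuousLinearMap ℂ (fun _ : ℤ => WithLp 2 (H × H)) 2 m).continuous
    refine hdd.induction_on (p := fun v => S (lp.single 2 m v) n = ((n : ℂ) - m) • B (lp.single 2 m v) n) v
      (isClosed_eq (hcont S) ((continuous_const_smul ((n : ℂ) - m)).comp (hcont B))) ?_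
    rintro ⟨x, y⟩
    obtain ⟨hx, hy, e1⟩ := IsCommutator.entry hT (hc m n) x y
    obtain ⟨_, _, e2⟩ := IsCommutator.entry hT (hc m n) y x
    change (2 * Complex.I)⁻¹ • pairSign H (pairSwap H
        (T (lp.single 2 m (WithLp.toLp 2 ((x : H), (y : H)))) n) -
      T (J (lp.single 2 m (WithLp.toLp 2 ((x : H), (y : H))))) n) = _
    rw [ampliation_lp_single, e1, pairSwap_toLp (x : H) (y : H), e2, pairSwap_toLp, pairSign_apply, hc]
    have hI : (2 * Complex.I)⁻¹ * (2 * Complex.I) = 1 := inv_mul_cancel₀ (by simp)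
    refine pair_ext ?_ ?_
    · change (2 * Complex.I)⁻¹ • ((D ⟨c m n x, hx⟩ - c m n (D x) +
          (Complex.I * ((n : ℂ) - m)) • c m n x) - (D ⟨c m n x, hx⟩ - c m n (D x) -
          (Complex.I * ((n : ℂ) - m)) • c m n x)) = ((n : ℂ) - m) • c m n x
      match_scalars <;> first | ring1 | linear_combination ((n : ℂ) - m) * hI
    · change (2 * Complex.I)⁻¹ • (-((D ⟨c m n y, hy⟩ - c m n (D y) -
          (Complex.I * ((n : ℂ) - m)) • c m n y) - (D ⟨c m n y, hy⟩ - c m n (D y) +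
          (Complex.I * ((n : ℂ) - m)) • c m n y))) = ((n : ℂ) - m) • c m n y
      match_scalars <;> first | ring1 | linear_combination ((n : ℂ) - m) * hI

end Entries

end SpectralData

namespace SpectralData

variable {A : Type*} [CStarAlgebra A] {H : Type*} [NormedAddCommGroup H]
  [InnerProductSpace ℂ H] [CompleteSpace H] (X : SpectralData A H) (α : A ≃⋆ₐ[ℂ] A)

section Fourier

variable (hπ : Function.Injective X.rep)

theorem rep_regularRepresentation_lp_single (b : CrossedProductZ α) (m n : ℤ)
    (v : WithLp 2 (H × H)) : (X.regularRepresentation α).rep b (lp.single 2 m v) n =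
      WithLp.toLp 2 (X.rep ((α ^ (-n)) (fourierCoeff α X.rep hπ (n - m) b)) v.fst,
        X.rep ((α ^ (-n)) (fourierCoeff α X.rep hπ (n - m) b)) v.snd) :=
  regRep_lp_single α X.rep hπ b m n v

theorem rep_regularRepresentation_lp_single_zero (b : CrossedProductZ α) (k : ℤ)
    (v : WithLp 2 (H × H)) : (X.regularRepresentation α).rep b (lp.single 2 (-k) v) 0 =
      WithLp.toLp 2 (X.rep (fourierCoeff α X.rep hπ k b) v.fst,
        X.rep (fourierCoeff α X.rep hπ k b) v.snd) := by
  have h := X.rep_regularRepresentation_lp_single α hπ b (-k) 0 v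
  rw [sub_neg_eq_add, zero_add, neg_zero, zpow_zero] at h
  exact h

theorem exists_isCommutator_fourierCoeff {b : CrossedProductZ α} {T : RegSpace H →L[ℂ] RegSpace H}
    (hT : IsCommutator (X.regularRepresentation α).dirac ((X.regularRepresentation α).rep b) T)
    (k : ℤ) :
    ∃ S, IsCommutator X.dirac (X.rep (fourierCoeff α X.rep hπ k b)) S ∧ ‖S‖ ≤ ‖T‖ :=
  IsCommutator.exists_entry hT (X.rep_regularRepresentation_lp_single_zero α hπ b k)

theorem fourierCoeff_mem_lipBall {b : CrossedProductZ α}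
    (hb : b ∈ (X.regularRepresentation α).lipBall) (k : ℤ) :
    fourierCoeff α X.rep hπ k b ∈ X.lipBall := by
  obtain ⟨T, hT, hle⟩ := hb
  obtain ⟨S, hS, hSle⟩ := X.exists_isCommutator_fourierCoeff α hπ hT k
  exact ⟨S, hS, hSle.trans hle⟩

theorem fourierCoeff_mem_commutant {b : CrossedProductZ α}
    (hb : b ∈ (X.regularRepresentation α).commutant) (k : ℤ) :
    fourierCoeff α X.rep hπ k b ∈ X.commutant := by
  obtain ⟨S, hS, hSle⟩ := X.exists_isCommutator_fourierCoeff α hπ (T := 0) hb k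
  rw [norm_zero] at hSle
  have h0 : S = 0 := norm_le_zero_iff.mp hSle
  rw [h0] at hS
  exact hS

/-- The commutator of `b` with the number operator, which has Fourier coefficients `k bₖ`,
is bounded by the commutator with `D̂`. -/
theorem exists_number_commutator_bound (hπ : Function.Injective X.rep)
    (hd : Dense (X.dirac.domain : Set H)) : ∃ M : ℝ, 0 ≤ M ∧ ∀ (b : CrossedProductZ α) (T : RegSpace H →L[ℂ] RegSpace H),
      IsCommutator (X.regularRepresentation α).dirac ((X.regularRepresentation α).rep b) T →
      ∃ S : RegSpace H →L[ℂ] RegSpace H, ‖S‖ ≤ M * ‖T‖ ∧ ∀ m n v, S (lp.single 2 m v) n =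
        ((n : ℂ) - m) • (X.regularRepresentation α).rep b (lp.single 2 m v) n :=
  ⟨2 * ‖ampliation ((2 * Complex.I)⁻¹ • pairSign H)‖ * ‖ampliation (pairSwap H)‖,
    mul_nonneg (mul_nonneg zero_le_two (norm_nonneg (ampliation _)))
      (norm_nonneg (ampliation (pairSwap H))),
    fun b _ hT => IsCommutator.exists_number_commutator hd hT
      fun m n v => X.rep_regularRepresentation_lp_single α hπ b m n v⟩

theorem exists_mul_norm_fourierCoeff_le (hd : Dense (X.dirac.domain : Set H)) :
    ∃ M : ℝ, 0 ≤ M ∧ ∀ (b : CrossedProductZ α) (T : RegSpace H →L[ℂ] RegSpace H),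
      IsCommutator (X.regularRepresentation α).dirac ((X.regularRepresentation α).rep b) T →
      ∀ k : ℤ, |(k : ℝ)| * ‖fourierCoeff α X.rep hπ k b‖ ≤ M * ‖T‖ := by
  obtain ⟨M, hM, h⟩ := X.exists_number_commutator_bound α hπ hd
  refine ⟨M, hM, fun b T hT k => ?_⟩
  obtain ⟨S, hS, hSe⟩ := h b T hT
  have h1 : ‖(k : ℂ) • X.rep (fourierCoeff α X.rep hπ k b)‖ ≤ M * ‖T‖ := by
    refine ContinuousLinearMap.opNorm_le_bound _ (mul_nonneg hM (norm_nonneg T)) fun x => ?_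
    have h2 := hSe (-k) 0 (WithLp.toLp 2 (x, 0))
    rw [X.rep_regularRepresentation_lp_single_zero α hπ] at h2
    have h3 := congrArg WithLp.fst h2
    have h4 : (S (lp.single 2 (-k) (WithLp.toLp 2 (x, 0))) 0).fst =
        ((k : ℂ) • X.rep (fourierCoeff α X.rep hπ k b)) x := by
      rw [h3]
      change (((0 : ℤ) : ℂ) - ((-k : ℤ) : ℂ)) • X.rep (fourierCoeff α X.rep hπ k b) x = _
      push_cast
      rw [zero_sub, neg_neg]
      rfl
    rw [← h4]
    refine (WithLp.norm_fst_le H _).trans ((lp.norm_apply_le_norm (by norm_num) _ 0).trans ?_)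
    refine (S.le_of_opNorm_le hS _).trans_eq ?_
    rw [lp.norm_single (by norm_num), WithLp.norm_toLp_fst]
  rwa [norm_smul, NonUnitalStarAlgHom.norm_map X.rep hπ, Complex.norm_intCast] at h1

/-- Fourier series converge uniformly on the Lipschitz ball. -/
theorem exists_finset_norm_sub_sum_le (hd : Dense (X.dirac.domain : Set H)) {ε : ℝ} (hε : 0 < ε) :
    ∃ s : Finset ℤ, 0 ∈ s ∧ ∀ b ∈ (X.regularRepresentation α).lipBall,
      ‖b - ∑ k ∈ s, monomialCLM α k (fourierCoeff α X.rep hπ k b)‖ ≤ ε := by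
  obtain ⟨M, hM, h⟩ := X.exists_number_commutator_bound α hπ hd
  obtain ⟨s, hs0, hs⟩ := exists_finset_sum_inv_sq_le
    (div_pos hε (add_pos_of_nonneg_of_pos hM one_pos))
  refine ⟨s, hs0, ?_⟩
  rintro b ⟨T, hT, hle⟩
  obtain ⟨S, hS, hSe⟩ := h b T hT
  have hco : ∀ j, fourierCoeff α X.rep hπ j
      (b - ∑ k ∈ s, monomialCLM α k (fourierCoeff α X.rep hπ k b)) =
      if j ∈ s then 0 else fourierCoeff α X.rep hπ j b := fun j => by
    rw [map_sub, map_sum]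
    simp only [monomialCLM_apply, fourierCoeff_of, finCoeff_monomial, Finset.sum_ite_eq']
    split_ifs
    · exact sub_self _
    · exact sub_zero _
  rw [← norm_regRep α X.rep hπ]
  have hV := norm_le_of_toeplitz_multiplier (S := S) (V := (X.regularRepresentation α).rep
    (b - ∑ k ∈ s, monomialCLM α k (fourierCoeff α X.rep hπ k b))) (by positivity) hs
    fun m v n => by
      rw [hSe, X.rep_regularRepresentation_lp_single α hπ, hco]
      by_cases hj : n - m ∈ s
      · rw [if_pos hj, if_pos hj, zero_smul]
        refine pair_ext ?_ ?_ <;> simp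
      · have hne : (n : ℂ) - m ≠ 0 := by
          intro h0
          have : n - m = 0 := by exact_mod_cast h0
          exact hj (this ▸ hs0)
        rw [if_neg hj, if_neg hj, X.rep_regularRepresentation_lp_single α hπ, Int.cast_sub,
          inv_smul_smul₀ hne]
  refine hV.trans ?_
  have h1 : ‖S‖ ≤ M + 1 := hS.trans ((mul_le_of_le_one_right hM hle).trans (by linarith))
  calc ε / (M + 1) * ‖S‖ ≤ ε / (M + 1) * (M + 1) := by gcongr
    _ = ε := div_mul_cancel₀ _ (by positivity)

end Fourier

theorem rep_regularRepresentation_one (h1 : X.rep 1 = 1) :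
    (X.regularRepresentation α).rep 1 = 1 := by
  refine ContinuousLinearMap.ext fun f => lp.ext (funext fun n => ?_)
  change regRep α X.rep 1 f n = f n
  rw [← monomialCLM_zero_one, monomialCLM_apply, regRep_of, regRepFinite_monomial_apply,
    map_one, doubleRep_apply, h1, sub_zero]
  rfl

/-- The commutant of the regular representation is trivial. -/
theorem commutant_regularRepresentation (hπ : Function.Injective X.rep) (h1 : X.rep 1 = 1)
    (hd : Dense (X.dirac.domain : Set H)) (hX : X.commutant = Submodule.span ℂ {1}) :
    (X.regularRepresentation α).commutant = Submodule.span ℂ {1} := by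
  have hrep := X.rep_regularRepresentation_one α h1
  refine le_antisymm (fun b hb => ?_) ?_
  · obtain ⟨M, hM, h⟩ := X.exists_mul_norm_fourierCoeff_le α hπ hd
    have hk : ∀ k : ℤ, k ≠ 0 → fourierCoeff α X.rep hπ k b = 0 := fun k hk => by
      have h2 := h b 0 hb k
      rw [norm_zero, mul_zero] at h2
      have hk' : 0 < |(k : ℝ)| := abs_pos.mpr (Int.cast_ne_zero.mpr hk)
      exact norm_le_zero_iff.mp (nonpos_of_mul_nonpos_right h2 hk')
    have h0 := X.fourierCoeff_mem_commutant α hπ hb 0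
    rw [hX, Submodule.mem_span_singleton] at h0
    obtain ⟨z, hz⟩ := h0
    have hb' : b = z • 1 := by
      rw [← sub_eq_zero, ← norm_le_zero_iff]
      refine le_of_forall_pos_le_add fun ε hε => ?_
      obtain ⟨s, hs0, hs⟩ := X.exists_finset_norm_sub_sum_le α hπ hd hε
      have h3 := hs b ((X.regularRepresentation α).mem_lipBall_of_mem_commutant hb)
      rw [Finset.sum_eq_single_of_mem 0 hs0 fun k _ hk0 => by rw [hk k hk0, map_zero], ← hz,
        map_smul, monomialCLM_zero_one] at h3
      rwa [zero_add]
    rw [hb']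
    exact Submodule.smul_mem _ _ (Submodule.mem_span_singleton_self 1)
  · rw [Submodule.span_singleton_le_iff_mem]
    change IsCommutator _ _ _
    rw [hrep]
    exact isCommutator_one

end SpectralData

namespace CrossedProductZ

variable {A : Type*} [CStarAlgebra A] (α : A ≃⋆ₐ[ℂ] A)

theorem mem_of_isClosed {W : Submodule ℂ (CrossedProductZ α)}
    (hc : IsClosed (W : Set (CrossedProductZ α))) (h : ∀ k a, monomialCLM α k a ∈ W)
    (b : CrossedProductZ α) : b ∈ W := by
  induction b using induction_of with
  | hc => exact hc
  | h f =>
    induction f using induction_monomial with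
    | hm k a => exact h k a
    | ha f g hf hg => rw [of_add]; exact W.add_mem hf hg

theorem separableSpace [TopologicalSpace.SeparableSpace A] :
    TopologicalSpace.SeparableSpace (CrossedProductZ α) := by
  have h1 : TopologicalSpace.IsSeparable (⋃ k : ℤ, Set.range (monomialCLM α k)) :=
    .iUnion fun k => TopologicalSpace.isSeparable_range (monomialCLM α k).continuous
  have h2 := (h1.span (R := ℂ)).closure
  rw [← TopologicalSpace.isSeparable_univ_iff]
  refine h2.mono fun b _ => mem_of_isClosed α
    (W := (Submodule.span ℂ (⋃ k : ℤ, Set.range (monomialCLM α k))).topologicalClosure)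
    isClosed_closure (fun k a => ?_) b
  exact subset_closure (Submodule.subset_span (Set.mem_iUnion.mpr ⟨k, a, rfl⟩))

end CrossedProductZ

/-- A set approximated by compact sets is totally bounded. -/
theorem totallyBounded_of_approx {E : Type*} [PseudoMetricSpace E] {s : Set E}
    (h : ∀ ε > 0, ∃ K : Set E, IsCompact K ∧ ∀ x ∈ s, ∃ y ∈ K, dist x y ≤ ε) :
    TotallyBounded s := by
  refine Metric.totallyBounded_iff.mpr fun ε hε => ?_
  obtain ⟨K, hK, hs⟩ := h (ε / 2) (half_pos hε)
  obtain ⟨t, ht, hKt⟩ := Metric.totallyBounded_iff.mp hK.totallyBounded (ε / 2) (half_pos hε)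
  refine ⟨t, ht, fun x hx => ?_⟩
  obtain ⟨y, hy, hxy⟩ := hs x hx
  obtain ⟨z, hz, hyz⟩ := Set.mem_iUnion₂.mp (hKt hy)
  refine Set.mem_iUnion₂.mpr ⟨z, hz, ?_⟩
  rw [Metric.mem_ball] at *
  linarith [dist_triangle x y z]

theorem exists_dual_one (A : Type*) [CStarAlgebra A] : ∃ φ : A →L[ℂ] ℂ, φ 1 • (1 : A) = 1 := by
  rcases subsingleton_or_nontrivial A with h | h
  · exact ⟨0, Subsingleton.elim _ _⟩
  · obtain ⟨φ, hφ⟩ := SeparatingDual.exists_eq_one (R := ℂ) (one_ne_zero (α := A))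
    exact ⟨φ, by rw [hφ, one_smul]⟩

theorem IsStrictlyPositiveElement.isUnit {A : Type*} [CStarAlgebra A] {h : A}
    (hh : IsStrictlyPositiveElement h) : IsUnit h := by
  obtain ⟨_, ⟨a, rfl⟩, u, ha⟩ := hh.2.exists_mem_open Units.isOpen ⟨(1 : A), isUnit_one⟩
  have hl : (↑u⁻¹ * h * a) * h = 1 := by
    rw [mul_assoc, mul_assoc, ← mul_assoc h a h]
    exact (congrArg _ ha.symm).trans u.inv_mul
  have hr : h * (a * h * ↑u⁻¹) = 1 := by
    rw [← mul_assoc, ← mul_assoc]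
    exact (congrArg (· * _) ha.symm).trans u.mul_inv
  exact ⟨⟨h, a * h * ↑u⁻¹, hr, by rw [← left_inv_eq_right_inv hl hr]; exact hl⟩, rfl⟩

namespace SpectralData

variable {A : Type*} [CStarAlgebra A] {H : Type*} [NormedAddCommGroup H]
  [InnerProductSpace ℂ H] [CompleteSpace H] (X : SpectralData A H)

/-- The Lipschitz ball of a compact spectral metric space is precompact modulo scalars. -/
theorem exists_isCompact_sub_smul_one_mem (hX : X.IsCompactSpectralMetricSpace) {φ : A →L[ℂ] ℂ}
    (hφ : φ 1 • (1 : A) = 1) : ∃ K : Set A, IsCompact K ∧ ∀ a ∈ X.lipBall, a - φ a • 1 ∈ K := by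
  obtain ⟨h, hh, hC⟩ := hX.precompact_lipBall
  obtain ⟨u, rfl⟩ := hh.isUnit
  let ψ : A →L[ℂ] A := ContinuousLinearMap.id ℂ A - φ.smulRight 1
  have hψ : ∀ a, ψ a = a - φ a • 1 := fun _ => rfl
  have hψ1 : ψ 1 = 0 := by rw [hψ, hφ, sub_self]
  have hker : X.commutant ≤ LinearMap.ker (ψ : A →ₗ[ℂ] A) := by
    rw [hX.commutant_eq, Submodule.span_singleton_le_iff_mem]
    exact hψ1
  let Φ := X.commutant.liftQ (ψ : A →ₗ[ℂ] A) hker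
  have hΦ : Continuous Φ := X.commutant.isQuotientMap_mkQ.continuous_iff.mpr ψ.continuous
  have hK₀ := hC.image hΦ
  have hmem : ∀ a ∈ X.lipBall, ψ (u * a * u) ∈
      Φ '' closure (X.commutant.mkQ '' ((fun a => (u : A) * a * u) '' X.lipBall)) := fun a ha =>
    ⟨_, subset_closure ⟨_, ⟨a, ha, rfl⟩, rfl⟩, rfl⟩
  have hsq : ψ ((u : A) * u) = 0 := by
    obtain ⟨R, hR⟩ := hK₀.isBounded.exists_norm_le
    by_contra hne
    have hpos := norm_pos_iff.mpr hne
    have h1 : ∀ t : ℂ, ‖t‖ * ‖ψ ((u : A) * u)‖ ≤ R := fun t => by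
      have h2 := hR _ (hmem (t • 1) (X.mem_lipBall_of_mem_commutant (by
        rw [hX.commutant_eq]
        exact Submodule.smul_mem _ _ (Submodule.mem_span_singleton_self 1))))
      rwa [mul_smul_comm, mul_one, smul_mul_assoc, map_smul, norm_smul] at h2
    have h3 := h1 ((|R| + 1) / ‖ψ ((u : A) * u)‖ : ℝ)
    rw [Complex.norm_real, Real.norm_of_nonneg (by positivity), div_mul_cancel₀ _ hpos.ne'] at h3
    linarith [le_abs_self R]
  rw [hψ, sub_eq_zero] at hsq
  have hinv : (↑u⁻¹ * ↑u⁻¹ : A) = (φ ((u : A) * u))⁻¹ • 1 := by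
    have h1 : (1 : A) = φ ((u : A) * u) • (↑u⁻¹ * ↑u⁻¹ : A) := by
      rw [← mul_one (φ ((u : A) * u) • (↑u⁻¹ * ↑u⁻¹ : A)), smul_mul_assoc, ← mul_smul_comm, ← hsq]
      simp [mul_assoc]
    by_cases h0 : φ ((u : A) * u) = 0
    · rw [h0, zero_smul] at h1
      rw [← mul_one (↑u⁻¹ * ↑u⁻¹ : A), h1, mul_zero, smul_zero]
    · rw [eq_inv_smul_iff₀ h0]
      exact h1.symm
  refine ⟨_, hK₀.image (f := fun k => ψ (↑u⁻¹ * k * ↑u⁻¹)) (by fun_prop), fun a ha =>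
    ⟨_, hmem a ha, ?_⟩⟩
  have h1 : (↑u⁻¹ * ψ (u * a * u) * ↑u⁻¹ : A) =
      a - φ (u * a * u) • (φ ((u : A) * u))⁻¹ • 1 := by
    rw [← hinv, hψ, mul_sub, sub_mul]
    simp [mul_assoc]
  change ψ (↑u⁻¹ * ψ (u * a * u) * ↑u⁻¹) = _
  rw [h1, map_sub, map_smul, map_smul, hψ1, smul_zero, smul_zero, sub_zero, hψ]

variable (α : A ≃⋆ₐ[ℂ] A)

theorem totallyBounded_lipBall_regularRepresentation (hX : X.IsCompactSpectralMetricSpace)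
    {φ : A →L[ℂ] ℂ} (hφ : φ 1 • (1 : A) = 1) :
    TotallyBounded ((fun b => b - φ (fourierCoeff α X.rep hX.faithful 0 b) • 1) ''
      (X.regularRepresentation α).lipBall) := by
  have hd := hX.isSelfAdjoint.dense_domain
  obtain ⟨K, hK, hKmem⟩ := X.exists_isCompact_sub_smul_one_mem hX hφ
  obtain ⟨M, hM, hMle⟩ := X.exists_mul_norm_fourierCoeff_le α hX.faithful hd
  let Q : Set A := K ∪ (fun p : A × ℂ => p.1 + p.2 • (1 : A)) ''
    (K ×ˢ Metric.closedBall (0 : ℂ) (‖φ‖ * M))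
  have hQ : IsCompact Q := hK.union
    ((hK.prod (isCompact_closedBall _ _)).image (by fun_prop))
  refine totallyBounded_of_approx fun ε hε => ?_
  obtain ⟨s, hs0, hs⟩ := X.exists_finset_norm_sub_sum_le α hX.faithful hd hε
  refine ⟨_, (isCompact_univ_pi fun _ : ℤ => hQ).image
    (f := fun a : ℤ → A => ∑ k ∈ s, monomialCLM α k (a k)) (by fun_prop), ?_⟩
  rintro _ ⟨b, hb, rfl⟩
  let c : ℤ → A := fun k => fourierCoeff α X.rep hX.faithful k b
  refine ⟨_, ⟨fun k => c k - if k = 0 then φ (c 0) • 1 else 0, fun k _ => ?_, rfl⟩, ?_⟩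
  · have hck := X.fourierCoeff_mem_lipBall α hX.faithful hb k
    by_cases hk : k = 0
    · left
      subst hk
      simpa using hKmem _ hck
    · right
      refine ⟨(c k - φ (c k) • 1, φ (c k)), ⟨hKmem _ hck, ?_⟩, by simp [hk]⟩
      rw [mem_closedBall_zero_iff]
      refine (φ.le_opNorm _).trans (mul_le_mul_of_nonneg_left ?_ (norm_nonneg _))
      obtain ⟨T, hT, hle⟩ := hb
      have h1 := hMle b T hT k
      have h2 : (1 : ℝ) ≤ |(k : ℝ)| := by exact_mod_cast Int.one_le_abs hk
      calc ‖c k‖ ≤ |(k : ℝ)| * ‖c k‖ := le_mul_of_one_le_left (norm_nonneg _) h2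
        _ ≤ M * ‖T‖ := h1
        _ ≤ M := mul_le_of_le_one_right hM hle
  · have e : ∑ k ∈ s, monomialCLM α k (c k - if k = 0 then φ (c 0) • 1 else 0) =
        ∑ k ∈ s, monomialCLM α k (c k) - φ (c 0) • 1 := by
      have e' : ∑ k ∈ s, monomialCLM α k (if k = 0 then φ (c 0) • 1 else 0) = φ (c 0) • 1 := by
        rw [Finset.sum_eq_single_of_mem 0 hs0 fun k _ hk => by rw [if_neg hk, map_zero],
          if_pos rfl, map_smul, monomialCLM_zero_one]
      simp only [map_sub, Finset.sum_sub_distrib, e']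
    rw [dist_eq_norm]
    change ‖b - φ (c 0) • 1 - ∑ k ∈ s, monomialCLM α k (c k - if k = 0 then φ (c 0) • 1 else 0)‖ ≤ ε
    rw [e, sub_sub_sub_cancel_right]
    exact hs b hb

theorem isCompact_image_lipBall_regularRepresentation (hX : X.IsCompactSpectralMetricSpace) :
    IsCompact ((X.regularRepresentation α).commutant.mkQ ''
      (X.regularRepresentation α).lipBall) := by
  obtain ⟨φ, hφ⟩ := exists_dual_one A
  have h1 : (1 : CrossedProductZ α) ∈ (X.regularRepresentation α).commutant := by
    change IsCommutator _ _ _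
    rw [X.rep_regularRepresentation_one α (X.rep_one hX.nondegenerate)]
    exact isCommutator_one
  have hcl := (X.regularRepresentation α).isClosed_image_lipBall
    (isSelfAdjoint_l2Sum_diracBlock hX.isSelfAdjoint)
  have htb := (X.totallyBounded_lipBall_regularRepresentation α hX hφ).image
    (f := (X.regularRepresentation α).commutant.mkQL)
    (X.regularRepresentation α).commutant.mkQL.uniformContinuous
  rw [Set.image_image] at htb
  have e : (fun b => (X.regularRepresentation α).commutant.mkQL
      (b - φ (fourierCoeff α X.rep hX.faithful 0 b) • 1)) =
      (X.regularRepresentation α).commutant.mkQ := by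
    funext b
    change (X.regularRepresentation α).commutant.mkQ _ = _
    rw [map_sub, sub_eq_self, Submodule.mkQ_apply, Submodule.Quotient.mk_eq_zero]
    exact Submodule.smul_mem _ _ h1
  rw [e] at htb
  exact htb.isCompact_of_isClosed hcl

/-- Monomials with coefficients of bounded commutators along the orbit are in `C¹`. -/
theorem monomialCLM_mem_C1 {a : A} (ha : a ∈ X.C1b (Subgroup.zpowers α)) (k : ℤ) :
    monomialCLM α k a ∈ (X.regularRepresentation α).C1 := by
  obtain ⟨C, hC⟩ := ha
  choose T hT hle using fun n : ℤ => hC (α ^ (-n)) (Subgroup.zpow_mem_zpowers α (-n))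
  let c : ℤ → H →L[ℂ] H := fun n => X.rep ((α ^ (-n)) a)
  have hc : ∀ n, ‖c n‖ ≤ ‖a‖ := fun n => (NonUnitalStarAlgHom.norm_apply_le X.rep _).trans
    (StarAlgEquiv.norm_map (α ^ (-n)) a).le
  let W : ℤ → WithLp 2 (H × H) →L[ℂ] WithLp 2 (H × H) := fun n =>
    pairInl H ∘L (T n - (Complex.I * k) • c n) ∘L WithLp.sndL 2 ℂ H H +
      pairInr H ∘L (T n + (Complex.I * k) • c n) ∘L WithLp.fstL 2 ℂ H H
  have hI : ‖(Complex.I * k : ℂ)‖ = |(k : ℝ)| := by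
    rw [norm_mul, Complex.norm_I, one_mul, Complex.norm_intCast]
  have hW : ∀ n, ‖W n‖ ≤ 2 * (C + |(k : ℝ)| * ‖a‖) := by
    intro n
    have h0 : 0 ≤ C + |(k : ℝ)| * ‖a‖ :=
      add_nonneg ((norm_nonneg (T n)).trans (hle n)) (by positivity)
    have hs : ‖(Complex.I * k : ℂ) • c n‖ ≤ |(k : ℝ)| * ‖a‖ := by
      rw [norm_smul, hI]
      exact mul_le_mul_of_nonneg_left (hc n) (abs_nonneg _)
    refine ContinuousLinearMap.opNorm_le_bound _ (by positivity) fun v => ?_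
    have h1 : ‖(T n - (Complex.I * k : ℂ) • c n) v.snd‖ ≤ (C + |(k : ℝ)| * ‖a‖) * ‖v‖ :=
      ContinuousLinearMap.le_of_opNorm_le_of_le _
        ((norm_sub_le _ _).trans (add_le_add (hle n) hs)) (WithLp.norm_snd_le H v)
    have h2 : ‖(T n + (Complex.I * k : ℂ) • c n) v.fst‖ ≤ (C + |(k : ℝ)| * ‖a‖) * ‖v‖ :=
      ContinuousLinearMap.le_of_opNorm_le_of_le _
        ((norm_add_le _ _).trans (add_le_add (hle n) hs)) (WithLp.norm_fst_le H v)
    change ‖pairInl H ((T n - (Complex.I * k : ℂ) • c n) v.snd) +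
      pairInr H ((T n + (Complex.I * k : ℂ) • c n) v.fst)‖ ≤ _
    refine (norm_add_le _ _).trans ?_
    rw [pairInl_apply, pairInr_apply, WithLp.norm_toLp_fst, WithLp.norm_toLp_snd]
    linarith
  have hW0 : 0 ≤ 2 * (C + |(k : ℝ)| * ‖a‖) := (norm_nonneg (W 0)).trans (hW 0)
  refine ⟨lp.mapCLM 2 W hW0 hW ∘L shift H (Multiplicative.ofAdd k), fun f => ?_⟩
  have hB : ∀ (g : RegSpace H) n, (X.regularRepresentation α).rep (monomialCLM α k a) g n =
      WithLp.toLp 2 (c n (g (n - k)).fst, c n (g (n - k)).snd) := fun g n => by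
    change regRep α X.rep (monomialCLM α k a) g n = _
    rw [monomialCLM_apply, regRep_of, regRepFinite_monomial_apply]
    rfl
  have hdom : ∀ n, (X.regularRepresentation α).rep (monomialCLM α k a) f n ∈
      (diracBlock X.dirac n).domain := fun n => by
    rw [hB]
    exact ⟨(hT n ⟨_, (f.2.1 (n - k)).1⟩).1, (hT n ⟨_, (f.2.1 (n - k)).2⟩).1⟩
  have heq : ∀ n, diracBlock X.dirac n ⟨_, hdom n⟩ =
      ((X.regularRepresentation α).rep (monomialCLM α k a) ((X.regularRepresentation α).dirac f) +
        (lp.mapCLM 2 W hW0 hW ∘L shift H (Multiplicative.ofAdd k)) f) n := fun n => by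
    obtain ⟨h1, e1⟩ := hT n ⟨_, (f.2.1 (n - k)).1⟩
    obtain ⟨h2, e2⟩ := hT n ⟨_, (f.2.1 (n - k)).2⟩
    have e3 : (⟨_, hdom n⟩ : (diracBlock X.dirac n).domain) =
      ⟨WithLp.toLp 2 (c n (f.1 (n - k)).fst, c n (f.1 (n - k)).snd), h1, h2⟩ :=
      Subtype.ext (hB f n)
    rw [e3, lp.coeFn_add, Pi.add_apply, hB]
    refine pair_ext ?_ ?_
    · change X.dirac ⟨c n (f.1 (n - k)).snd, h2⟩ - (Complex.I * n) • c n (f.1 (n - k)).snd =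
        c n (X.dirac ⟨(f.1 (n - k)).snd, _⟩ - (Complex.I * (n - k : ℤ)) • (f.1 (n - k)).snd) +
        (T n (f.1 (n - k)).snd - (Complex.I * k) • c n (f.1 (n - k)).snd + 0)
      have e : T n (f.1 (n - k)).snd = X.dirac ⟨c n (f.1 (n - k)).snd, h2⟩ -
          c n (X.dirac ⟨(f.1 (n - k)).snd, (f.2.1 (n - k)).2⟩) := e2.symm
      rw [e, map_sub, map_smul]
      push_cast
      module
    · change X.dirac ⟨c n (f.1 (n - k)).fst, h1⟩ + (Complex.I * n) • c n (f.1 (n - k)).fst =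
        c n (X.dirac ⟨(f.1 (n - k)).fst, _⟩ + (Complex.I * (n - k : ℤ)) • (f.1 (n - k)).fst) +
        (0 + (T n (f.1 (n - k)).fst + (Complex.I * k) • c n (f.1 (n - k)).fst))
      have e : T n (f.1 (n - k)).fst = X.dirac ⟨c n (f.1 (n - k)).fst, h1⟩ -
          c n (X.dirac ⟨(f.1 (n - k)).fst, (f.2.1 (n - k)).1⟩) := e1.symm
      rw [e, map_add, map_smul]
      push_cast
      module
  have hmem : (X.regularRepresentation α).rep (monomialCLM α k a) f ∈
      (X.regularRepresentation α).dirac.domain :=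
    ⟨hdom, by
      rw [show (fun n => diracBlock X.dirac n ⟨_, hdom n⟩) = _ from funext heq]
      exact lp.memℓp _⟩
  exact ⟨hmem, sub_eq_of_eq_add' (lp.ext (funext heq))⟩

theorem dense_C1_regularRepresentation (hdense : Dense X.C1)
    (hα : X.IsEquicontinuous (Subgroup.zpowers α)) : Dense (X.regularRepresentation α).C1 :=
  mem_of_isClosed α (W := (X.regularRepresentation α).C1Submodule.topologicalClosure)
    isClosed_closure fun k a => map_mem_closure (monomialCLM α k).continuous (hdense a)
      fun _ hb => X.monomialCLM_mem_C1 α (hα.subset hb) k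

theorem isCompactSpectralMetricSpace_regularRepresentation (hX : X.IsCompactSpectralMetricSpace)
    (hα : X.IsEquicontinuous (Subgroup.zpowers α)) :
    (X.regularRepresentation α).IsCompactSpectralMetricSpace := by
  have h1 := X.rep_one hX.nondegenerate
  have hrep := X.rep_regularRepresentation_one α h1
  have := hX.separable
  exact
    { separable := CrossedProductZ.separableSpace α
      faithful := regRep_injective α X.rep hX.faithful
      isSelfAdjoint := isSelfAdjoint_l2Sum_diracBlock hX.isSelfAdjoint
      compactResolvent := hasCompactResolvent_l2Sum_diracBlock hX.isSelfAdjoint hX.compactResolvent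
      dense_C1 := X.dense_C1_regularRepresentation α hX.dense_C1 hα
      nondegenerate := by
        rw [eq_top_iff]
        exact fun y _ => subset_closure (Submodule.subset_span ⟨1, y, by rw [hrep]; rfl⟩)
      commutant_eq := X.commutant_regularRepresentation α hX.faithful h1
        hX.isSelfAdjoint.dense_domain hX.commutant_eq
      precompact_lipBall := by
        refine ⟨1, ⟨⟨1, by rw [star_one, one_mul]⟩, ?_⟩, ?_⟩
        · simpa only [one_mul, mul_one] using Set.range_id.symm ▸ dense_univ
        · simp only [one_mul, mul_one, Set.image_id']
          exact (X.isCompact_image_lipBall_regularRepresentation α hX).closure }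

end SpectralData
end

theorem mainTheorem4 {A : Type*} [CStarAlgebra A]
    {H : Type*} [NormedAddCommGroup H] [InnerProductSpace ℂ H] [CompleteSpace H]
    (X : SpectralData A H) (hX : X.IsCompactSpectralMetricSpace)
    (α : A ≃⋆ₐ[ℂ] A) (hα : X.IsEquicontinuous (Subgroup.zpowers α)) :
    IsCompact ((X.regularRepresentation α).commutant.mkQ ''
        (X.regularRepresentation α).lipBall) ∧
      (X.regularRepresentation α).IsCompactSpectralMetricSpace :=
  ⟨X.isCompact_image_lipBall_regularRepresentation α hX,
    X.isCompactSpectralMetricSpace_regularRepresentation α hX hα⟩
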